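/- Consider the uplink of a system with $L>1$ cells, each with $K$ single-antenna users and a base station (BS) with $M\ge K\ge 1$ antennas; fix the BS of cell $\ell$. The $M\times K$ channel matrix from the users of cell $i$ to this BS is $G_i=H_iD_i^{1/2}$ with $D_i=\mathrm{diag}(\beta_{i,1},\dots,\beta_{i,K})$, $\beta_{i,k}>0$. All users transmit with average power $P_{\mathrm u}>0$. *Channel estimation.* All cells use the same $\tau_{\mathrm u}\times K$ pilot matrix $\Psi$ with $\Psi^\dagger\Psi=I_K$. The BS receives $Y_p=\sqrt{\tau_{\mathrm u}P_{\mathrm u}}\sum_{i=1}^L G_i\Psi^T+N$ and forms $\tilde Y_p=Y_p\Psi^*$. The MMSE estimate $\hat G_i$ of $G_i$ has as $k$-th column $\sqrt{\tau_{\mathrm u}P_{\mathrm u}}\,\beta_{i,k}\bigl(\tau_{\mathrm u}P_{\mathrm u}\sum_{j}\beta_{j,k}+1\bigr)^{-1}$ times the $k$-th column of $\tilde Y_p$; the estimation error is $\xi_i=G_i-\hat G_i$. *Data transmission.* The users of cell $i$ send a symbol vector $x_i\in\mathbb C^K$ with $\mathbb E[x_ix_i^\dagger]=I_K$, and the noise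 vector at the BS is $n$. All entries of the $H_i$, of $N$ and of $n$ are mutually independent $\mathcal{CN}(0,1)$ variables, and the symbols $(x_i)_i$ are independent of them. With the zero-forcing receiver $A=\hat G_\ell(\hat G_\ell^\dagger\hat G_\ell)^{-1}$, with columns $a_k$, the instantaneous SINR of the $k$-th user of cell $\ell$ is $$\gamma_{\ell,k}=\Bigl(\mathbb E\bigl[|a_k^\dagger\xi_\ell x_\ell|^2\,\big|\,\hat G_\ell\bigr]+\mathbb E\Bigl[\sum_{i\ne\ell}|a_k^\dagger G_ix_i|^2\,\Big|\,\hat G_\ell\Bigr]+\mathbb E\bigl[|a_k^\dagger n|^2/P_{\mathrm u}\,\big|\,\hat G_\ell\bigr]\Bigr)^{-1}.$$ *Constants.* Put $$\alpha_i=\tfrac1M\,\mathrm{tr}\,\mathbb E[\xi_i\xi_i^\dagger],\qquad \hat\beta_k=\sum_{j=1}^L\beta_{j,k}+\frac1{\tau_{\mathrm u}P_{\mathrm u}},$$ $$\eta=\frac{\sum_{i\ne\ell}\beta_{i,k}^2}{\beta_{\ell,k}^2},\qquad \theta=\frac{\hat\beta_k}{\beta_{\ell,k}^2}\Bigl(\sum_{i=1}^L\alpha_i+\frac1{P_{\mathrm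 u}}\Bigr).$$ **Claim.** For every $i$, $$\alpha_i=\sum_{j=1}^K\Bigl(\beta_{i,j}-\frac{\tau_{\mathrm u}P_{\mathrm u}\beta_{i,j}^2}{\tau_{\mathrm u}P_{\mathrm u}\sum_{i'=1}^L\beta_{i',j}+1}\Bigr),$$ and for every threshold $\gamma_{\mathrm{th}}\ge0$ the outage probability $P_{\mathrm{out}}=\Pr(\gamma_{\ell,k}<\gamma_{\mathrm{th}})$ is $$P_{\mathrm{out}}=1-\exp\Bigl(-\frac{\theta\gamma_{\mathrm{th}}}{1-\eta\gamma_{\mathrm{th}}}\Bigr)\sum_{i=0}^{M-K}\frac1{i!}\Bigl(\frac{\theta\gamma_{\mathrm{th}}}{1-\eta\gamma_{\mathrm{th}}}\Bigr)^i\quad\text{if }\gamma_{\mathrm{th}}<1/\eta,\qquad P_{\mathrm{out}}=1\quad\text{if }\gamma_{\mathrm{th}}\ge1/\eta .$$ -/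

import Mathlib

open MeasureTheory ProbabilityTheory
open scoped ENNReal Matrix

/-- The circularly symmetric complex Gaussian law `CN(0, 1)`: real and imaginary parts are
independent real Gaussians of mean `0` and variance `1/2`. -/
noncomputable def stdComplexGaussian : Measure ℂ :=
  ((gaussianReal 0 (1 / 2)).prod (gaussianReal 0 (1 / 2))).map
    (fun p : ℝ × ℝ => (⟨p.1, p.2⟩ : ℂ))

/-- Parameters and random signals of the multicell uplink, as seen by the base station of one
fixed cell. There are `L` cells, `K` users in each cell, `M` antennas at the base station, and
`τ` pilot symbols. -/
structure UplinkSystem (L M K τ : ℕ) (Ω : Type*) where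
  /-- the cell to which the base station belongs -/
  cell : Fin L
  /-- average transmit power `P_u` of each user -/
  power : ℝ
  /-- `gain i k`: large-scale fading from user `k` of cell `i` to the base station -/
  gain : Fin L → Fin K → ℝ
  /-- pilot matrix, common to all cells -/
  pilot : Matrix (Fin τ) (Fin K) ℂ
  /-- `fading i`: fast-fading matrix from the users of cell `i` to the base station -/
  fading : Fin L → Ω → Matrix (Fin M) (Fin K) ℂ
  /-- noise matrix during the pilot phase -/
  pilotNoise : Ω → Matrix (Fin M) (Fin τ) ℂ
  /-- noise vector during the data phase -/
  noise : Ω → Fin M → ℂ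
  /-- `symbol i`: vector of data symbols sent by the users of cell `i` -/
  symbol : Fin L → Ω → Fin K → ℂ

namespace UplinkSystem

variable {L M K τ : ℕ} {Ω : Type*}

/-- All fading coefficients and all noise samples (pilot and data phase), as a single family. -/
def gaussianFamily (S : UplinkSystem L M K τ Ω) :
    (Fin L × Fin M × Fin K) ⊕ (Fin M × Fin τ) ⊕ Fin M → Ω → ℂ :=
  Sum.elim (fun q ω => S.fading q.1 ω q.2.1 q.2.2)
    (Sum.elim (fun q ω => S.pilotNoise ω q.1 q.2) (fun m ω => S.noise ω m))

/-- The standing assumptions of the system model. -/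
structure Model [MeasurableSpace Ω] (S : UplinkSystem L M K τ Ω) (μ : Measure Ω) : Prop where
  power_pos : 0 < S.power
  gain_pos : ∀ i k, 0 < S.gain i k
  /-- the `K` pilot sequences are orthonormal -/
  pilot_orthonormal : S.pilotᴴ * S.pilot = 1
  measurable_gaussian : ∀ s, Measurable (S.gaussianFamily s)
  /-- fading coefficients and noise samples are standard complex Gaussian -/
  law_gaussian : ∀ s, μ.map (S.gaussianFamily s) = stdComplexGaussian
  /-- fading coefficients and noise samples are mutually independent -/
  indep_gaussian : iIndepFun S.gaussianFamily μ
  measurable_symbol : ∀ i k, Measurable (fun ω => S.symbol i ω k)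
  /-- `E[x_i x_i†] = I` -/
  symbol_covariance : ∀ i k k', ∫ ω, S.symbol i ω k * star (S.symbol i ω k') ∂μ =
    (1 : Matrix (Fin K) (Fin K) ℂ) k k'
  /-- the data symbols are independent of the channels and of the noise -/
  indep_symbol : IndepFun (fun ω i k => S.symbol i ω k) (fun ω s => S.gaussianFamily s ω) μ

variable (S : UplinkSystem L M K τ Ω)

/-- `G_i = H_i D_i^{1/2}`, the channel matrix from cell `i` to the base station. -/
noncomputable def channel (i : Fin L) (ω : Ω) : Matrix (Fin M) (Fin K) ℂ :=
  S.fading i ω * Matrix.diagonal (fun k => (Real.sqrt (S.gain i k) : ℂ))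

/-- The received pilot matrix `Y_p = √(τ P) ∑ G_i Ψᵀ + N`. -/
noncomputable def receivedPilot (ω : Ω) : Matrix (Fin M) (Fin τ) ℂ :=
  (Real.sqrt (τ * S.power) : ℂ) • ∑ i, S.channel i ω * S.pilotᵀ + S.pilotNoise ω

/-- The received pilot matrix projected on the conjugate pilots, `Y_p Ψ*`. -/
noncomputable def projectedPilot (ω : Ω) : Matrix (Fin M) (Fin K) ℂ :=
  S.receivedPilot ω * S.pilot.map star

/-- The MMSE estimate of the channel matrix from cell `i`: its `k`-th column is
`√(τ P) β_{i,k} (τ P ∑_j β_{j,k} + 1)⁻¹` times the `k`-th column of the projected pilots. -/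
noncomputable def channelEstimate (i : Fin L) (ω : Ω) : Matrix (Fin M) (Fin K) ℂ :=
  S.projectedPilot ω * Matrix.diagonal (fun k =>
    ((Real.sqrt (τ * S.power) * S.gain i k / (τ * S.power * ∑ j, S.gain j k + 1) : ℝ) : ℂ))

/-- The channel estimation error `ξ_i = G_i - Ĝ_i`. -/
noncomputable def estimationError (i : Fin L) (ω : Ω) : Matrix (Fin M) (Fin K) ℂ :=
  S.channel i ω - S.channelEstimate i ω

/-- The zero-forcing receiver `A = Ĝ (Ĝ† Ĝ)⁻¹`, with `Ĝ` the estimate of the own channel. -/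
noncomputable def zfReceiver (ω : Ω) : Matrix (Fin M) (Fin K) ℂ :=
  S.channelEstimate S.cell ω *
    ((S.channelEstimate S.cell ω)ᴴ * S.channelEstimate S.cell ω)⁻¹

/-- The information available at the receiver: the σ-algebra generated by the entries of the
estimate of the own channel. -/
noncomputable abbrev csi : MeasurableSpace Ω :=
  MeasurableSpace.comap (fun ω (m : Fin M) (k : Fin K) => S.channelEstimate S.cell ω m k)
    inferInstance

variable [MeasurableSpace Ω]

/-- The power of interference and noise in the `k`-th stream after zero forcing, relative to `P_u`,
given the channel estimate: the sum of the conditional expectations of `|a_k† ξ x|²` (own cell),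
of `∑ |a_k† G_i x_i|²` (other cells) and of `|a_k† n|² / P_u`. -/
noncomputable def interferencePower (μ : Measure Ω) (k : Fin K) (ω : Ω) : ℝ≥0∞ :=
  condLExp S.csi μ (fun ω => ‖((S.zfReceiver ω)ᴴ *ᵥ
      (S.estimationError S.cell ω *ᵥ S.symbol S.cell ω)) k‖ₑ ^ 2) ω
  + condLExp S.csi μ (fun ω => ∑ i ∈ Finset.univ.erase S.cell,
      ‖((S.zfReceiver ω)ᴴ *ᵥ (S.channel i ω *ᵥ S.symbol i ω)) k‖ₑ ^ 2) ω
  + condLExp S.csi μ (fun ω =>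
      ‖((S.zfReceiver ω)ᴴ *ᵥ S.noise ω) k‖ₑ ^ 2 / ENNReal.ofReal S.power) ω

/-- The instantaneous SINR of user `k` of the cell. -/
noncomputable def sinr (μ : Measure Ω) (k : Fin K) (ω : Ω) : ℝ≥0∞ :=
  (S.interferencePower μ k ω)⁻¹

/-- The outage probability: the probability that the SINR falls below the threshold. -/
noncomputable def outageProbability (μ : Measure Ω) (k : Fin K) (threshold : ℝ) : ℝ :=
  μ.real {ω | S.sinr μ k ω < ENNReal.ofReal threshold}

/-- `α_i = (1/M) tr E[ξ_i ξ_i†]`, the mean power of the estimation error per antenna. -/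
noncomputable def errorPower (μ : Measure Ω) (i : Fin L) : ℝ :=
  (Matrix.trace (Matrix.of fun m m' : Fin M =>
    ∫ ω, (S.estimationError i ω * (S.estimationError i ω)ᴴ) m m' ∂μ)).re / M

/-- `η = ∑_{i ≠ ℓ} β_{i,k}² / β_{ℓ,k}²`. -/
noncomputable def eta (k : Fin K) : ℝ :=
  (∑ i ∈ Finset.univ.erase S.cell, S.gain i k ^ 2) / S.gain S.cell k ^ 2

/-- `β̂_k = ∑_j β_{j,k} + 1 / (τ P)`. -/
noncomputable def betaHat (k : Fin K) : ℝ :=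
  ∑ j, S.gain j k + 1 / (τ * S.power)

/-- `θ = (β̂_k / β_{ℓ,k}²) (∑_i α_i + 1 / P)`. -/
noncomputable def theta (μ : Measure Ω) (k : Fin K) : ℝ :=
  S.betaHat k / S.gain S.cell k ^ 2 * (∑ i, S.errorPower μ i + 1 / S.power)

end UplinkSystem

/-! Projected pilots, estimation errors and data noise are linear images of one standard complex
Gaussian vector. That law is preserved by matrices with orthonormal rows
(`map_mulVec_pi_stdComplexGaussian`), so two such images with mutually orthogonal rows are
independent. The MMSE coefficient is exactly the one making ξ_i orthogonal to the pilots
(`normErrorMatrix_mul_normPilotMatrix_conjTranspose`). Hence each ξ_i, like the noise, is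
independent of Ĝ_ℓ, and the variances of its entries give α_i.

Since all cells share the pilots, Ĝ_i is Ĝ_ℓ with its columns rescaled by β_{i,j}/β_{ℓ,j}
(`channelEstimate_eq_cell_mul`). As a_k†Ĝ_ℓ = e_k†, cell i ≠ ℓ contributes the fixed leak
(β_{i,k}/β_{ℓ,k}) x_{i,k} plus its error seen through a_k. Conditioning on Ĝ_ℓ freezes a_k
(`condLExp_comap_of_indepFun`), and the interference power is almost surely η + ‖a_k‖²(∑ α_i + 1/P)
(`interferencePower_ae_eq`).

It remains to find the law of ‖a_k‖². Its inverse is the squared distance from the k-th column to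
the span of the others (`zfNormSq_mul_eq_one`). For standard Gaussian columns, that is the squared
norm of a standard Gaussian vector in dimension M-K+1, a sum of M-K+1 independent unit exponentials
with Erlang tail (`pi_stdComplexGaussian_zfNormSq`). The k-th column of Ĝ_ℓ has entries of variance
β_{ℓ,k}²/β̂_k, which produces θ. With E the Erlang variable, outage means 1 < ηγ + θγ/E: certain if
ηγ ≥ 1, and E < θγ/(1-ηγ) otherwise. -/

/-! ### Standard complex Gaussian vectors and their invariance -/

instance : IsProbabilityMeasure stdComplexGaussian :=
  Measure.isProbabilityMeasure_map (Complex.measurableEquivRealProd.symm.measurable.aemeasurable)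

lemma charFunDual_gaussianReal_zero (v : NNReal) (L : StrongDual ℝ ℝ) :
    charFunDual (gaussianReal 0 v) L = Complex.exp (-(v * (L 1 : ℂ) ^ 2 / 2)) := by
  have h := charFun_gaussianReal (μ := 0) (v := v) (L 1)
  rw [charFun_apply_real] at h
  rw [charFunDual_apply]
  convert h using 1
  · congr 1 with x
    congr 2
    have : L x = L 1 * x := by
      conv_lhs => rw [← mul_one x, ← smul_eq_mul, map_smul, smul_eq_mul, mul_comm]
    rw [this]; push_cast; ring
  · congr 1; simp

lemma charFunDual_stdComplexGaussian (L : StrongDual ℝ ℂ) :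
    charFunDual stdComplexGaussian L =
      Complex.exp (-(((L 1) ^ 2 + (L Complex.I) ^ 2 : ℝ) / 4)) := by
  have h : stdComplexGaussian = ((gaussianReal 0 (1 / 2)).prod (gaussianReal 0 (1 / 2))).map
      (Complex.equivRealProdCLM.symm : ℝ × ℝ →L[ℝ] ℂ) := rfl
  rw [h, charFunDual_map, charFunDual_prod, charFunDual_gaussianReal_zero,
    charFunDual_gaussianReal_zero, ← Complex.exp_add]
  have h1 : Complex.equivRealProdCLM.symm ((1 : ℝ), (0 : ℝ)) = 1 := by
    apply Complex.ext <;> simp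
  have h2 : Complex.equivRealProdCLM.symm ((0 : ℝ), (1 : ℝ)) = Complex.I := by
    apply Complex.ext <;> simp
  congr 1
  simp [h1, h2]
  ring

/-- A real-linear functional on `ℂ` is the real part of the multiplication by a number. -/
lemma strongDual_complex_apply (L : StrongDual ℝ ℂ) (z : ℂ) :
    L z = ((⟨L 1, -L Complex.I⟩ : ℂ) * z).re := by
  conv_lhs => rw [← Complex.re_add_im z]
  have h : ((z.re : ℂ) + z.im * Complex.I) = z.re • (1 : ℂ) + z.im • Complex.I := by
    simp
  rw [h, map_add, map_smul, map_smul]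
  simp [Complex.mul_re]
  ring

section Pi

variable {ι κ : Type*} [Fintype ι] [Fintype κ]

lemma ofReal_sum_norm_sq (u : ι → ℂ) : ((∑ i, ‖u i‖ ^ 2 : ℝ) : ℂ) = u ⬝ᵥ star u := by
  simp [dotProduct, Complex.mul_conj, Complex.normSq_eq_norm_sq]

/-- Only the Euclidean norm of the vector `w` representing `L` enters: this is the source of the
invariance under coisometries. -/
lemma charFunDual_pi_stdComplexGaussian [DecidableEq ι] (w : ι → ℂ) (L : StrongDual ℝ (ι → ℂ))
    (hL : ∀ i z, L (Pi.single i z) = (w i * z).re) :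
    charFunDual (Measure.pi fun _ : ι => stdComplexGaussian) L =
      Complex.exp (-((∑ i, ‖w i‖ ^ 2 : ℝ) / 4)) := by
  rw [charFunDual_pi]
  simp_rw [charFunDual_stdComplexGaussian]
  rw [← Complex.exp_sum, Finset.sum_neg_distrib, ← Finset.sum_div]
  congr 3
  rw [Complex.ofReal_sum]
  refine Finset.sum_congr rfl fun i _ => ?_
  congr 1
  simp only [ContinuousLinearMap.comp_apply, ContinuousLinearMap.single_apply, hL]
  rw [Complex.sq_norm, Complex.normSq_apply]
  simp
  ring

/-- The standard complex Gaussian law is preserved by coisometries. -/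
theorem map_mulVec_pi_stdComplexGaussian [DecidableEq κ] (T : Matrix κ ι ℂ) (hT : T * Tᴴ = 1) :
    (Measure.pi fun _ : ι => stdComplexGaussian).map (fun x => T *ᵥ x) =
      Measure.pi fun _ : κ => stdComplexGaussian := by
  classical
  let TL : (ι → ℂ) →L[ℝ] (κ → ℂ) :=
    LinearMap.toContinuousLinearMap ((Matrix.mulVecLin T).restrictScalars ℝ)
  have hTL : ⇑TL = fun x => T *ᵥ x := rfl
  rw [← hTL]
  refine Measure.ext_of_charFunDual <| funext fun L => ?_
  let w : κ → ℂ := fun i => ⟨L (Pi.single i 1), -L (Pi.single i Complex.I)⟩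
  have hw : ∀ i z, L (Pi.single i z) = (w i * z).re := fun i z =>
    strongDual_complex_apply (L.comp (ContinuousLinearMap.single ℝ (fun _ => ℂ) i)) z
  rw [charFunDual_map, charFunDual_pi_stdComplexGaussian w L hw,
    charFunDual_pi_stdComplexGaussian (w ᵥ* T)]
  -- ‖wT‖² = w T T† w† = ‖w‖².
  · congr 3
    rw [ofReal_sum_norm_sq, ofReal_sum_norm_sq, Matrix.star_vecMul, ← Matrix.dotProduct_mulVec, Matrix.mulVec_mulVec, hT,
      Matrix.one_mulVec]
  · intro i z
    have : T *ᵥ Pi.single i z = ∑ j, Pi.single j (T j i * z) := by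
      rw [Finset.univ_sum_single, Matrix.mulVec_single]
      ext j; simp
    change L (T *ᵥ Pi.single i z) = _
    rw [this, map_sum]
    simp_rw [hw]
    rw [← Complex.re_sum, Matrix.vecMul, dotProduct, Finset.sum_mul]
    simp_rw [mul_assoc]

/-- Blocks of standard complex Gaussians obtained by linear maps with orthonormal, mutually
orthogonal rows are independent and standard. -/
theorem map_mulVec_prod_pi_stdComplexGaussian {κ' : Type*} [Fintype κ'] [DecidableEq κ]
    [DecidableEq κ'] (T : Matrix κ ι ℂ) (T' : Matrix κ' ι ℂ) (hT : T * Tᴴ = 1)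
    (hT' : T' * T'ᴴ = 1) (h : T * T'ᴴ = 0) :
    (Measure.pi fun _ : ι => stdComplexGaussian).map (fun x => (T *ᵥ x, T' *ᵥ x)) =
      (Measure.pi fun _ : κ => stdComplexGaussian).prod
        (Measure.pi fun _ : κ' => stdComplexGaussian) := by
  have h' : T' * Tᴴ = 0 := by
    have := congrArg Matrix.conjTranspose h
    simpa using this
  -- Stacking the two blocks gives a single coisometry, and the product law then splits.
  have key := map_mulVec_pi_stdComplexGaussian (Matrix.fromRows T T') (by
    rw [Matrix.conjTranspose_fromRows_eq_fromCols_conjTranspose, Matrix.fromRows_mul_fromCols,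
      hT, hT', h, h', Matrix.fromBlocks_one])
  have e := (measurePreserving_sumPiEquivProdPi
    (fun _ : κ ⊕ κ' => stdComplexGaussian)).map_eq
  rw [← key, Measure.map_map (MeasurableEquiv.measurable _) (by fun_prop)] at e
  rw [← e]
  congr 1

lemma lintegral_neg_pi_stdComplexGaussian (f : (ι → ℂ) → ℝ≥0∞) (hf : Measurable f) :
    ∫⁻ z, f (-z) ∂(Measure.pi fun _ : ι => stdComplexGaussian) =
      ∫⁻ z, f z ∂(Measure.pi fun _ : ι => stdComplexGaussian) := by
  classical
  have h := map_mulVec_pi_stdComplexGaussian (-1 : Matrix ι ι ℂ) (by simp)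
  conv_rhs => rw [← h, lintegral_map hf (by fun_prop)]
  simp [Matrix.neg_mulVec]

end Pi

/-! ### Exponential and Erlang laws, second moments -/

lemma lintegral_stdComplexGaussian (f : ℂ → ℝ≥0∞) (hf : Measurable f) :
    ∫⁻ z, f z ∂stdComplexGaussian =
      ∫⁻ z, ENNReal.ofReal (Real.pi⁻¹ * Real.exp (-‖z‖ ^ 2)) * f z := by
  have hv : (1 / 2 : NNReal) ≠ 0 := by norm_num
  have hm : Measurable (fun p : ℝ × ℝ => (⟨p.1, p.2⟩ : ℂ)) :=
    Complex.measurableEquivRealProd.symm.measurable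
  rw [stdComplexGaussian, lintegral_map hf hm, gaussianReal_of_var_ne_zero _ hv,
    prod_withDensity (by fun_prop) (by fun_prop),
    lintegral_withDensity_eq_lintegral_mul _ (by fun_prop) (by fun_prop),
    ← (Complex.volume_preserving_equiv_real_prod.symm).lintegral_comp_emb
    Complex.measurableEquivRealProd.symm.measurableEmbedding]
  refine lintegral_congr fun p => ?_
  change _ = ENNReal.ofReal (Real.pi⁻¹ * Real.exp (-‖(⟨p.1, p.2⟩ : ℂ)‖ ^ 2)) * f ⟨p.1, p.2⟩
  simp only [Pi.mul_apply, gaussianPDF]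
  rw [← ENNReal.ofReal_mul (gaussianPDFReal_nonneg _ _ _)]
  congr 2
  rw [gaussianPDFReal, gaussianPDFReal, Complex.sq_norm, Complex.normSq_mk]
  simp only [NNReal.coe_div, NNReal.coe_one, NNReal.coe_ofNat, sub_zero]
  rw [show 2 * Real.pi * (1 / 2) = Real.pi by ring]
  rw [mul_mul_mul_comm, ← Real.exp_add, ← mul_inv, Real.mul_self_sqrt Real.pi_pos.le]
  congr 2
  ring

/-- The squared modulus of a standard complex Gaussian is exponentially distributed. -/
theorem lintegral_norm_sq_stdComplexGaussian (f : ℝ → ℝ≥0∞) (hf : Measurable f) :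
    ∫⁻ z, f (‖z‖ ^ 2) ∂stdComplexGaussian =
      ∫⁻ u in Set.Ioi 0, ENNReal.ofReal (Real.exp (-u)) * f u := by
  rw [lintegral_stdComplexGaussian _ (by fun_prop), ← Complex.lintegral_comp_polarCoord_symm,
    polarCoord_target, Measure.volume_eq_prod, ← Measure.prod_restrict,
    lintegral_prod _ (by
      refine Measurable.aemeasurable ?_
      simp only [Complex.norm_polarCoord_symm]
      fun_prop)]
  have himg : (fun r : ℝ => r ^ 2) '' Set.Ioi 0 = Set.Ioi 0 := by
    ext u
    constructor
    · rintro ⟨r, hr, rfl⟩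
      exact pow_pos (Set.mem_Ioi.1 hr) 2
    · intro hu
      exact ⟨Real.sqrt u, Real.sqrt_pos.2 hu, Real.sq_sqrt (le_of_lt hu)⟩
  -- After polar coordinates, the substitution u = r² absorbs the Jacobian r, and the angle
  -- contributes 2π.
  have hcv := lintegral_image_eq_lintegral_abs_deriv_mul (s := Set.Ioi (0 : ℝ))
    (f := fun r : ℝ => r ^ 2) (f' := fun r => 2 * r) measurableSet_Ioi
    (fun r _ => by simpa using (hasDerivAt_pow 2 r).hasDerivWithinAt)
    (fun a ha b hb h => (pow_left_inj₀ (le_of_lt ha) (le_of_lt hb) two_ne_zero).1 h)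
    (fun u => ENNReal.ofReal (Real.exp (-u)) * f u)
  rw [himg] at hcv
  rw [hcv]
  refine setLIntegral_congr_fun measurableSet_Ioi fun r hr => ?_
  have hr' : (0 : ℝ) < r := hr
  simp only [Complex.norm_polarCoord_symm, sq_abs, lintegral_const, smul_eq_mul,
    Measure.restrict_apply MeasurableSet.univ, Set.univ_inter, Real.volume_Ioo]
  rw [abs_of_pos (by positivity), ← mul_assoc, ← mul_assoc, mul_right_comm,
    ← ENNReal.ofReal_mul hr'.le, ← ENNReal.ofReal_mul (by positivity),
    ← ENNReal.ofReal_mul (by positivity)]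
  congr 2
  field_simp
  ring

/-- The second moment of a standard complex Gaussian is `1`. -/
lemma lintegral_enorm_sq_stdComplexGaussian : ∫⁻ z, ‖z‖ₑ ^ 2 ∂stdComplexGaussian = 1 := by
  have h := lintegral_norm_sq_stdComplexGaussian (fun u => ENNReal.ofReal u) (by fun_prop)
  have h1 : ∀ z : ℂ, ENNReal.ofReal (‖z‖ ^ 2) = ‖z‖ₑ ^ 2 := fun z => by
    rw [ENNReal.ofReal_pow (norm_nonneg z), ofReal_norm]
  simp_rw [h1] at h
  rw [h]
  -- The integrand u e^{-u} is the Gamma(2, 1) density, of total mass 1.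
  have h2 : ∀ u ∈ Set.Ioi (0 : ℝ), ENNReal.ofReal (Real.exp (-u)) * ENNReal.ofReal u =
      gammaPDF 2 1 u := by
    intro u hu
    rw [gammaPDF_of_nonneg (le_of_lt hu), ← ENNReal.ofReal_mul (by positivity)]
    congr 1
    norm_num [Real.Gamma_two]
    ring
  have h3 := lintegral_add_compl (μ := volume) (gammaPDF 2 1) (measurableSet_Ioi (a := (0 : ℝ)))
  rw [Set.compl_Ioi, setLIntegral_congr Iio_ae_eq_Iic.symm, lintegral_gammaPDF_of_nonpos le_rfl,
    add_zero, lintegral_gammaPDF_eq_one two_pos one_pos] at h3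
  rw [setLIntegral_congr_fun measurableSet_Ioi h2, h3]

/-- Tail function of the sum of `n` independent standard exponential variables. -/
noncomputable def erlangTail (n : ℕ) (x : ℝ) : ℝ :=
  Real.exp (-x) * ∑ i ∈ Finset.range n, x ^ i / (i.factorial : ℝ)

lemma continuous_erlangTail (n : ℕ) : Continuous (erlangTail n) := by
  unfold erlangTail; fun_prop

lemma erlangTail_nonneg (n : ℕ) {x : ℝ} (hx : 0 ≤ x) : 0 ≤ erlangTail n x := by
  unfold erlangTail; positivity

lemma erlangTail_zero (n : ℕ) : erlangTail (n + 1) 0 = 1 := by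
  simp [erlangTail, Finset.sum_range_succ']

/-- Recursion obtained by conditioning on the first exponential u < x; the subtracted `exp (-x)` is
the event that this variable alone reaches x. -/
lemma integral_exp_mul_erlangTail (n : ℕ) (x : ℝ) :
    ∫ u in (0 : ℝ)..x, Real.exp (-u) * erlangTail n (x - u) =
      erlangTail (n + 1) x - Real.exp (-x) := by
  have h : ∀ u, Real.exp (-u) * erlangTail n (x - u) =
      Real.exp (-x) * ∑ i ∈ Finset.range n, (x - u) ^ i / (i.factorial : ℝ) := fun u => by
    rw [erlangTail, ← mul_assoc, ← Real.exp_add]; congr 2; ring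
  simp_rw [h]
  rw [intervalIntegral.integral_const_mul, intervalIntegral.integral_finsetSum
    (fun i _ => Continuous.intervalIntegrable (by fun_prop) _ _), erlangTail,
    Finset.sum_range_succ']
  simp only [pow_zero, Nat.factorial_zero, Nat.cast_one, div_one, mul_add, mul_one, add_sub_cancel_right]
  congr 1
  refine Finset.sum_congr rfl fun i _ => ?_
  rw [intervalIntegral.integral_div,
    intervalIntegral.integral_comp_sub_left (fun u => u ^ i) x, integral_pow, Nat.factorial_succ]
  push_cast
  have : (i.factorial : ℝ) ≠ 0 := by positivity
  have : ((i : ℝ) + 1) ≠ 0 := by positivity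
  field_simp
  simp

/-- The squared norm of a standard complex Gaussian vector has the Erlang distribution. -/
lemma pi_stdComplexGaussian_tail_of_pos (n : ℕ) {x : ℝ} (hx : 0 < x) :
    (Measure.pi fun _ : Fin n => stdComplexGaussian) {z | x ≤ ∑ i, ‖z i‖ ^ 2} =
      ENNReal.ofReal (erlangTail n x) := by
  induction n generalizing x with
  -- The empty sum is 0, so this case needs x > 0.
  | zero => simp [erlangTail, not_le.2 hx]
  | succ n ih =>
    have hms : ∀ (m : ℕ) (y : ℝ), MeasurableSet {z : Fin m → ℂ | y ≤ ∑ i, ‖z i‖ ^ 2} :=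
      fun m y => measurableSet_le (by fun_prop) (by fun_prop)
    have hmp := (measurePreserving_piFinSuccAbove
      (fun _ : Fin (n + 1) => stdComplexGaussian) 0).symm
    rw [← hmp.measure_preimage (hms _ _).nullMeasurableSet, Measure.prod_apply
      (hmp.measurable (hms _ _))]
    -- Conditional probability of the tail event when the first squared modulus equals u.
    let F : ℝ → ℝ≥0∞ := fun u => if u < x then ENNReal.ofReal (erlangTail n (x - u)) else 1
    have hF : Measurable F := Measurable.ite measurableSet_Iio
      ((continuous_erlangTail n).measurable.comp (by fun_prop)).ennreal_ofReal measurable_const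
    have hsec : ∀ z : ℂ, (Measure.pi fun _ : Fin n => stdComplexGaussian)
        (Prod.mk z ⁻¹' ((MeasurableEquiv.piFinSuccAbove (fun _ : Fin (n + 1) => ℂ) 0).symm ⁻¹'
          {z | x ≤ ∑ i, ‖z i‖ ^ 2})) = F (‖z‖ ^ 2) := by
      intro z
      have : (Prod.mk z ⁻¹' ((MeasurableEquiv.piFinSuccAbove (fun _ : Fin (n + 1) => ℂ) 0).symm ⁻¹'
          {z | x ≤ ∑ i, ‖z i‖ ^ 2})) = {w : Fin n → ℂ | x - ‖z‖ ^ 2 ≤ ∑ i, ‖w i‖ ^ 2} := by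
        ext w
        simp [MeasurableEquiv.piFinSuccAbove, Fin.sum_univ_succ, add_comm (‖z‖ ^ 2)]
      rw [this]
      by_cases hz : ‖z‖ ^ 2 < x
      · simp only [F, if_pos hz]
        exact ih (sub_pos.2 hz)
      · simp only [F, if_neg hz]
        have : {w : Fin n → ℂ | x - ‖z‖ ^ 2 ≤ ∑ i, ‖w i‖ ^ 2} = Set.univ :=
          Set.eq_univ_of_forall fun w => by
            have : 0 ≤ ∑ i, ‖w i‖ ^ 2 := by positivity
            simp only [Set.mem_ofPred_eq]
            linarith [not_lt.1 hz]
        rw [this, measure_univ]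
    simp_rw [hsec]
    have hsplit : Set.Ioi (0 : ℝ) = Set.Ioo 0 x ∪ Set.Ici x := (Set.Ioo_union_Ici_eq_Ioi hx).symm
    have h1 : ∫⁻ u in Set.Ioo 0 x, ENNReal.ofReal (Real.exp (-u)) * F u =
        ENNReal.ofReal (erlangTail (n + 1) x - Real.exp (-x)) := by
      rw [← integral_exp_mul_erlangTail, intervalIntegral.integral_of_le hx.le,
        ofReal_integral_eq_lintegral_ofReal, setLIntegral_congr Ioo_ae_eq_Ioc.symm]
      · refine setLIntegral_congr_fun measurableSet_Ioo fun u hu => ?_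
        simp only [F, if_pos hu.2]
        rw [ENNReal.ofReal_mul (Real.exp_pos _).le]
      · have := continuous_erlangTail n
        exact (Continuous.integrableOn_Icc (by fun_prop)).mono_set Set.Ioc_subset_Icc_self
      · exact (ae_restrict_mem measurableSet_Ioc).mono fun u hu =>
          mul_nonneg (Real.exp_pos _).le (erlangTail_nonneg n (sub_nonneg.2 hu.2))
    have h2 : ∫⁻ u in Set.Ici x, ENNReal.ofReal (Real.exp (-u)) * F u =
        ENNReal.ofReal (Real.exp (-x)) := by
      rw [setLIntegral_congr Ioi_ae_eq_Ici.symm, ← integral_exp_neg_Ioi x,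
        ofReal_integral_eq_lintegral_ofReal (integrableOn_exp_neg_Ioi x)
          (Filter.Eventually.of_forall fun u => (Real.exp_pos _).le)]
      refine setLIntegral_congr_fun measurableSet_Ioi fun u hu => ?_
      simp [F, not_lt.2 (le_of_lt (Set.mem_Ioi.1 hu))]
    rw [lintegral_norm_sq_stdComplexGaussian F hF, hsplit, lintegral_union measurableSet_Ici
      (Set.disjoint_left.2 fun u hu hu' => not_lt.2 hu' hu.2), h1, h2, ← ENNReal.ofReal_add _
      (Real.exp_pos _).le, sub_add_cancel]
    rw [← integral_exp_mul_erlangTail]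
    exact intervalIntegral.integral_nonneg hx.le fun u hu =>
      mul_nonneg (Real.exp_pos _).le (erlangTail_nonneg n (sub_nonneg.2 hu.2))

theorem pi_stdComplexGaussian_tail (n : ℕ) {x : ℝ} (hx : 0 ≤ x) :
    (Measure.pi fun _ : Fin (n + 1) => stdComplexGaussian) {z | x ≤ ∑ i, ‖z i‖ ^ 2} =
      ENNReal.ofReal (erlangTail (n + 1) x) := by
  rcases hx.eq_or_lt with rfl | hx
  · have : {z : Fin (n + 1) → ℂ | 0 ≤ ∑ i, ‖z i‖ ^ 2} = Set.univ :=
      Set.eq_univ_of_forall fun z => by simp only [Set.mem_ofPred_eq]; positivity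
    rw [this, measure_univ, erlangTail_zero, ENNReal.ofReal_one]
  · exact pi_stdComplexGaussian_tail_of_pos _ hx

/-- Averaging over z and -z, the parallelogram law removes the cross term without any integrability
argument. For c = 0, the normalised row u/‖u‖ is a coisometry onto one coordinate, which reduces the
claim to a single Gaussian. -/
lemma lintegral_enorm_sq_dotProduct_add {ι : Type*} [Fintype ι] (u : ι → ℂ) (c : ℂ) :
    ∫⁻ z, ‖u ⬝ᵥ z + c‖ₑ ^ 2 ∂(Measure.pi fun _ : ι => stdComplexGaussian) =
      ∑ i, ‖u i‖ₑ ^ 2 + ‖c‖ₑ ^ 2 := by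
  classical
  set ν := Measure.pi fun _ : ι => stdComplexGaussian
  have hsq : ∀ w : ℂ, ENNReal.ofReal (‖w‖ ^ 2) = ‖w‖ₑ ^ 2 := fun w => by
    rw [ENNReal.ofReal_pow (norm_nonneg w), ofReal_norm]
  have hmeas : ∀ u : ι → ℂ, Measurable fun z : ι → ℂ => u ⬝ᵥ z := fun u => by
    unfold dotProduct; fun_prop
  have hpar : ∀ w : ℂ, ‖w + c‖ₑ ^ 2 + ‖-w + c‖ₑ ^ 2 = 2 * (‖w‖ₑ ^ 2 + ‖c‖ₑ ^ 2) := fun w => by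
    have := parallelogram_law_with_norm ℝ w c
    rw [← hsq, ← hsq, ← hsq, ← hsq, ← ENNReal.ofReal_add (by positivity) (by positivity),
      ← ENNReal.ofReal_add (by positivity) (by positivity),
      ← ENNReal.ofReal_ofNat 2, ← ENNReal.ofReal_mul (by norm_num)]
    congr 1
    rw [neg_add_eq_sub, norm_sub_rev c w]
    linarith
  have hsum : ∫⁻ z, ‖u ⬝ᵥ z‖ₑ ^ 2 ∂ν = ∑ i, ‖u i‖ₑ ^ 2 := by
    by_cases hu : u = 0
    · simp [hu]
    have hpos : 0 < ∑ i, ‖u i‖ ^ 2 := by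
      obtain ⟨i, hi⟩ := Function.ne_iff.1 hu
      exact Finset.sum_pos' (fun _ _ => by positivity)
        ⟨i, Finset.mem_univ i, by have := norm_pos_iff.2 hi; positivity⟩
    set s := Real.sqrt (∑ i, ‖u i‖ ^ 2)
    have hs : s ^ 2 = ∑ i, ‖u i‖ ^ 2 := Real.sq_sqrt hpos.le
    have hs0 : 0 < s := Real.sqrt_pos.2 hpos
    let T : Matrix Unit ι ℂ := Matrix.of fun _ i => (s : ℂ)⁻¹ * u i
    have hT : T * Tᴴ = 1 := by
      ext a b
      have h1 : (T * Tᴴ) a b = (s : ℂ)⁻¹ ^ 2 * (u ⬝ᵥ star u) := by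
        simp only [T, Matrix.mul_apply, Matrix.conjTranspose_apply, Matrix.of_apply, dotProduct,
          Finset.mul_sum, Pi.star_apply, star_mul', star_inv₀]
        refine Finset.sum_congr rfl fun i _ => ?_
        simp only [RCLike.star_def, Complex.conj_ofReal]
        ring
      rw [h1, ← ofReal_sum_norm_sq, ← hs]
      have : (s : ℂ) ≠ 0 := by exact_mod_cast hs0.ne'
      simp only [Complex.ofReal_pow, Matrix.one_apply_eq]
      field_simp
    have key := map_mulVec_pi_stdComplexGaussian T hT
    have h1 : ∀ z, ‖u ⬝ᵥ z‖ₑ ^ 2 = ENNReal.ofReal (s ^ 2) * ‖(T *ᵥ z) ()‖ₑ ^ 2 := fun z => by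
      have : u ⬝ᵥ z = s * (T *ᵥ z) () := by
        have : (s : ℂ) ≠ 0 := by exact_mod_cast hs0.ne'
        simp only [T, Matrix.mulVec, dotProduct, Matrix.of_apply, Finset.mul_sum]
        refine Finset.sum_congr rfl fun i _ => ?_
        field_simp
      rw [this, ← hsq, ← hsq, ← ENNReal.ofReal_mul (by positivity), norm_mul, mul_pow]
      simp
    have hev := (measurePreserving_eval (fun _ : Unit => stdComplexGaussian) ()).map_eq
    simp_rw [h1]
    rw [lintegral_const_mul _ (by unfold Matrix.mulVec dotProduct; fun_prop),
      ← lintegral_map (f := fun y : Unit → ℂ => ‖y ()‖ₑ ^ 2) (by fun_prop) (by fun_prop), key,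
      ← lintegral_map (f := fun y : ℂ => ‖y‖ₑ ^ 2) (g := fun y : Unit → ℂ => y ())
        (by fun_prop) (by fun_prop)]
    erw [hev]
    rw [lintegral_enorm_sq_stdComplexGaussian, mul_one, hs,
      ENNReal.ofReal_sum_of_nonneg fun _ _ => by positivity]
    simp_rw [hsq]
  have hm := hmeas u
  have h2 : 2 * ∫⁻ z, ‖u ⬝ᵥ z + c‖ₑ ^ 2 ∂ν = 2 * (∑ i, ‖u i‖ₑ ^ 2 + ‖c‖ₑ ^ 2) := by
    have hneg := lintegral_neg_pi_stdComplexGaussian (fun z => ‖u ⬝ᵥ z + c‖ₑ ^ 2) (by fun_prop)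
    simp only [dotProduct_neg] at hneg
    rw [two_mul]
    nth_rewrite 2 [← hneg]
    rw [← lintegral_add_left (by fun_prop)]
    simp_rw [hpar]
    rw [lintegral_const_mul _ (by fun_prop), lintegral_add_left (by fun_prop), hsum,
      lintegral_const, measure_univ, mul_one]
  exact (ENNReal.mul_right_inj two_ne_zero ENNReal.ofNat_ne_top).1 h2

/-! ### Geometry of the zero-forcing matrix -/

/-- Squared norm of the `k`-th column of the zero-forcing matrix `W (W† W)⁻¹`. -/
noncomputable def zfNormSq {m κ : Type*} [Fintype m] [Fintype κ] [DecidableEq κ]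
    (W : Matrix m κ ℂ) (k : κ) : ℝ :=
  ∑ i, ‖(W * (Wᴴ * W)⁻¹) i k‖ ^ 2

section Geometry

variable {m κ δ : Type*} [Fintype m] [Fintype κ] [Fintype δ] [DecidableEq κ]

-- W and W†W have the same kernel.
open scoped ComplexOrder in
lemma linearIndependent_col_iff_det_ne_zero (W : Matrix m κ ℂ) :
    LinearIndependent ℂ W.col ↔ (Wᴴ * W).det ≠ 0 := by
  classical
  rw [← Matrix.mulVec_injective_iff, ← isUnit_iff_ne_zero, ← Matrix.isUnit_iff_isUnit_det,
    ← Matrix.mulVec_injective_iff_isUnit]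
  have h := Matrix.ker_mulVecLin_conjTranspose_mul_self W
  constructor <;> intro hinj
  · have h1 : LinearMap.ker W.mulVecLin = ⊥ := LinearMap.ker_eq_bot.2 hinj
    rw [h1] at h
    exact LinearMap.ker_eq_bot.1 h
  · have h1 : LinearMap.ker (Wᴴ * W).mulVecLin = ⊥ := LinearMap.ker_eq_bot.2 hinj
    rw [h] at h1
    exact LinearMap.ker_eq_bot.1 h1

/-- The zero-forcing column a satisfies W†a = e_k, so it is orthogonal to the other columns and T†T
fixes it. Writing a = Wc, T sees only the k-th column w: Ta = c_k Tw. Hence 1 = w†a = w†T†Ta = c_k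
‖Tw‖², while c_k = ‖a‖². -/
lemma zfNormSq_mul_eq_one (W : Matrix m κ ℂ) (k : κ) (hW : (Wᴴ * W).det ≠ 0) (T : Matrix δ m ℂ)
    (hT : ∀ j ≠ k, T *ᵥ W.col j = 0)
    (hproj : ∀ a, (∀ j ≠ k, star (W.col j) ⬝ᵥ a = 0) → Tᴴ *ᵥ (T *ᵥ a) = a) :
    zfNormSq W k * ∑ i, ‖(T *ᵥ W.col k) i‖ ^ 2 = 1 := by
  set c : κ → ℂ := (Wᴴ * W)⁻¹.col k with hc
  set a : m → ℂ := W *ᵥ c with ha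
  have haq : ((zfNormSq W k : ℝ) : ℂ) = star a ⬝ᵥ a := by
    rw [zfNormSq, dotProduct_comm, ← ofReal_sum_norm_sq]
    rfl
  have hWa : Wᴴ *ᵥ a = Pi.single k 1 := by
    have h1 : (Wᴴ * W) * (Wᴴ * W)⁻¹ = 1 := Matrix.mul_nonsing_inv _ (isUnit_iff_ne_zero.2 hW)
    ext j
    have := congrFun (congrFun h1 j) k
    rw [Matrix.one_apply] at this
    rw [ha, Matrix.mulVec_mulVec, Pi.single_apply, ← this]
    rfl
  have hdot : ∀ j, star (W.col j) ⬝ᵥ a = Pi.single (M := fun _ => ℂ) k 1 j := fun j => by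
    rw [← hWa]; rfl
  have hq : star a ⬝ᵥ a = star (c k) := by
    conv_lhs => rw [ha, Matrix.star_mulVec, ← Matrix.dotProduct_mulVec, ← ha, hWa]
    simp
  have hTa : T *ᵥ a = c k • (T *ᵥ W.col k) := by
    have : a = ∑ j, c j • W.col j := by
      ext i; simp [ha, Matrix.mulVec, dotProduct, mul_comm]
    rw [this, Matrix.mulVec_sum, Finset.sum_eq_single k]
    · rw [Matrix.mulVec_smul]
    · intro j _ hj
      rw [Matrix.mulVec_smul, hT j hj, smul_zero]
    · simp
  have h1 : star (W.col k) ⬝ᵥ a = c k * ((∑ i, ‖(T *ᵥ W.col k) i‖ ^ 2 : ℝ) : ℂ) := by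
    conv_lhs => rw [← hproj a (fun j hj => by rw [hdot, Pi.single_eq_of_ne hj]), hTa,
      Matrix.dotProduct_mulVec, ← Matrix.star_mulVec, dotProduct_smul, dotProduct_comm,
      ← ofReal_sum_norm_sq]
    rfl
  rw [hdot, Pi.single_eq_same] at h1
  have h2 : c k = (zfNormSq W k : ℂ) := by
    have := congrArg star (haq.trans hq)
    simpa using this.symm
  rw [h2] at h1
  exact_mod_cast h1.symm

/-- Effect of a rescaling of the columns on the zero-forcing matrix. -/
lemma zfMatrix_mul_diagonal (W : Matrix m κ ℂ) (d : κ → ℂ) (hd : ∀ k, d k ≠ 0)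
    (hstar : ∀ k, star (d k) = d k) :
    (W * Matrix.diagonal d) * ((W * Matrix.diagonal d)ᴴ * (W * Matrix.diagonal d))⁻¹ =
      (W * (Wᴴ * W)⁻¹) * Matrix.diagonal (fun k => (d k)⁻¹) := by
  have h1 : Matrix.diagonal d * Matrix.diagonal (fun k => (d k)⁻¹) = 1 := by
    rw [Matrix.diagonal_mul_diagonal, ← Matrix.diagonal_one]
    congr 1
    ext k
    exact mul_inv_cancel₀ (hd k)
  have h2 : (Matrix.diagonal d)ᴴ = Matrix.diagonal d := by
    rw [Matrix.diagonal_conjTranspose]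
    congr 1
    ext k
    exact hstar k
  rw [Matrix.conjTranspose_mul, h2,
    show Matrix.diagonal d * Wᴴ * (W * Matrix.diagonal d) =
      Matrix.diagonal d * (Wᴴ * W * Matrix.diagonal d) by simp only [Matrix.mul_assoc],
    Matrix.mul_inv_rev, Matrix.mul_inv_rev, Matrix.inv_eq_right_inv h1,
    show W * Matrix.diagonal d * (Matrix.diagonal (fun k => (d k)⁻¹) * (Wᴴ * W)⁻¹ *
      Matrix.diagonal (fun k => (d k)⁻¹)) = W * (Matrix.diagonal d *
        Matrix.diagonal (fun k => (d k)⁻¹)) * (Wᴴ * W)⁻¹ * Matrix.diagonal (fun k => (d k)⁻¹) by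
      simp only [Matrix.mul_assoc], h1, Matrix.mul_one]

/-- A matrix whose rows form an orthonormal basis of the orthogonal complement of a linearly
independent family. -/
lemma exists_orthonormal_rows {M n : ℕ} (v : Fin n → Fin M → ℂ) (hv : LinearIndependent ℂ v) :
    ∃ T : Matrix (Fin (M - n)) (Fin M) ℂ, T * Tᴴ = 1 ∧ (∀ j, T *ᵥ v j = 0) ∧
      ∀ a, (∀ j, star (v j) ⬝ᵥ a = 0) → Tᴴ *ᵥ (T *ᵥ a) = a := by
  let e := (WithLp.linearEquiv 2 ℂ (Fin M → ℂ)).symm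
  let v' : Fin n → EuclideanSpace ℂ (Fin M) := fun j => e (v j)
  have hv' : LinearIndependent ℂ v' := hv.map' e.toLinearMap e.ker
  let V := Submodule.span ℂ (Set.range v')
  have hfin : Module.finrank ℂ Vᗮ = M - n := by
    have h1 := Submodule.finrank_add_finrank_orthogonal V
    have h2 : Module.finrank ℂ V = n := by
      simpa using finrank_span_eq_card hv'
    rw [h2, finrank_euclideanSpace_fin] at h1
    omega
  let b := (stdOrthonormalBasis ℂ Vᗮ).reindex (finCongr hfin)
  let T : Matrix (Fin (M - n)) (Fin M) ℂ := Matrix.of fun i j => star ((b i : EuclideanSpace ℂ (Fin M)) j)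
  have hTx : ∀ (x : Fin M → ℂ) i, (T *ᵥ x) i = inner ℂ (b i : EuclideanSpace ℂ (Fin M)) (e x) := by
    intro x i
    simp [T, Matrix.mulVec, dotProduct, PiLp.inner_apply, e, mul_comm]
  refine ⟨T, ?_, ?_, ?_⟩
  · ext i j
    have h1 : (T * Tᴴ) i j = inner ℂ (b i) (b j) := by
      simp [T, Matrix.mul_apply, PiLp.inner_apply, Submodule.coe_inner, mul_comm]
    rw [h1, orthonormal_iff_ite.1 b.orthonormal, Matrix.one_apply]
  · intro j
    ext i
    rw [hTx]
    exact Submodule.inner_left_of_mem_orthogonal (K := V)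
      (Submodule.subset_span (Set.mem_range_self j)) (b i).2
  · intro a ha
    have hmem : e a ∈ Vᗮ := by
      rw [Submodule.mem_orthogonal]
      intro u hu
      induction hu using Submodule.span_induction with
      | mem x hx =>
        obtain ⟨j, rfl⟩ := hx
        rw [← ha j]
        simp [v', e, dotProduct, PiLp.inner_apply, mul_comm]
      | zero => simp
      | add x y _ _ hx hy => rw [inner_add_left, hx, hy, add_zero]
      | smul c x _ hx => rw [inner_smul_left, hx, mul_zero]
    obtain ⟨y, hy⟩ : ∃ y : Vᗮ, (y : EuclideanSpace ℂ (Fin M)) = e a := ⟨⟨e a, hmem⟩, rfl⟩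
    have hs := congrArg (fun z : Vᗮ => (z : EuclideanSpace ℂ (Fin M))) (b.sum_repr' y)
    ext j
    have hj := congrArg (fun x : EuclideanSpace ℂ (Fin M) => x j) hs
    simp only [Submodule.coe_sum, Submodule.coe_smul, Submodule.coe_inner, hy] at hj
    have he : e a j = a j := rfl
    rw [← he, ← hj]
    simp [Matrix.mulVec, dotProduct, Matrix.conjTranspose_apply, T, PiLp.inner_apply, e, mul_comm]

end Geometry

lemma linearIndependent_insertNth {𝕜 E : Type*} [DivisionRing 𝕜] [AddCommGroup E] [Module 𝕜 E]
    {n : ℕ} (k : Fin (n + 1)) (x : E) (v : Fin n → E) (hv : LinearIndependent 𝕜 v)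
    (hx : x ∉ Submodule.span 𝕜 (Set.range v)) :
    LinearIndependent 𝕜 (Fin.insertNth (α := fun _ => E) k x v) := by
  have h := (linearIndependent_option' (K := 𝕜) (v := v) (x := x)).2 ⟨hv, hx⟩
  convert h.comp (finSuccEquiv' k) (finSuccEquiv' k).injective using 1
  ext i
  refine Fin.succAboveCases k ?_ (fun j => ?_) i <;> simp

/-! ### Measurability of the zero-forcing matrix -/

section Measurability

lemma continuous_gram {m κ : Type*} [Fintype m] : Continuous fun W : m → κ → ℂ => (Matrix.of W)ᴴ * Matrix.of W := by
  have h : Continuous fun W : m → κ → ℂ => (Matrix.of W) := continuous_id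
  exact h.matrix_conjTranspose.matrix_mul h

variable {m κ : Type*} [Fintype m] [Fintype κ] [DecidableEq κ]

/-- The inverse is the continuous adjugate times the inverse determinant, with 0⁻¹ = 0; singular
Gram matrices thus need no separate case. -/
lemma measurable_zfMatrix (i : m) (k : κ) :
    Measurable fun W : m → κ → ℂ =>
      ((Matrix.of W) * ((Matrix.of W)ᴴ * (Matrix.of W))⁻¹) i k := by
  have h := continuous_gram (m := m) (κ := κ)
  have hdet : Measurable fun W : m → κ → ℂ => ((Matrix.of W)ᴴ * Matrix.of W).det⁻¹ :=
    h.matrix_det.measurable.inv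
  have hadj : ∀ j, Measurable fun W : m → κ → ℂ => ((Matrix.of W)ᴴ * Matrix.of W).adjugate j k :=
    fun j => (h.matrix_adjugate.matrix_elem j k).measurable
  simp only [Matrix.mul_apply (M := Matrix.of _), Matrix.inv_def, Matrix.smul_apply, smul_eq_mul,
    Ring.inverse_eq_inv', Matrix.of_apply]
  refine Finset.measurable_fun_sum _ fun j _ => ?_
  exact Measurable.mul (by fun_prop) (hdet.mul (hadj j))

lemma measurable_zfNormSq (k : κ) : Measurable fun W : m → κ → ℂ => zfNormSq (Matrix.of W) k := by
  unfold zfNormSq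
  exact Finset.measurable_fun_sum _ fun i _ => ((measurable_zfMatrix i k).norm.pow_const 2)

end Measurability

/-! ### Law of a zero-forcing column of a Gaussian matrix -/

section Law

variable {M : ℕ}

lemma stdComplexGaussian_absolutelyContinuous : stdComplexGaussian ≪ volume := by
  refine Measure.AbsolutelyContinuous.mk fun s hs h0 => ?_
  rw [← lintegral_indicator_one hs, lintegral_stdComplexGaussian _ (measurable_one.indicator hs)]
  rw [lintegral_eq_zero_iff (by
    have : Measurable (s.indicator (1 : ℂ → ℝ≥0∞)) := measurable_one.indicator hs
    fun_prop)]
  filter_upwards [measure_eq_zero_iff_ae_notMem.1 h0] with z hz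
  simp [hz]

/-- A coisometry onto the orthogonal complement kills the span, yet its image is standard Gaussian
in dimension M - n > 0, where a coordinate vanishes with probability zero. -/
lemma pi_stdComplexGaussian_span {n : ℕ} (hn : n < M) (v : Fin n → Fin M → ℂ)
    (hv : LinearIndependent ℂ v) :
    (Measure.pi fun _ : Fin M => stdComplexGaussian) (Submodule.span ℂ (Set.range v)) = 0 := by
  obtain ⟨T, hT, hT0, -⟩ := exists_orthonormal_rows v hv
  have i₀ : Fin (M - n) := ⟨0, by omega⟩
  have hcn : stdComplexGaussian {0} = 0 :=
    stdComplexGaussian_absolutelyContinuous (measure_singleton 0)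
  have hz := (measurePreserving_eval (fun _ : Fin (M - n) => stdComplexGaussian) i₀).measure_preimage
    (measurableSet_singleton (0 : ℂ)).nullMeasurableSet
  rw [hcn, ← map_mulVec_pi_stdComplexGaussian T hT, Measure.map_apply (by fun_prop)
    ((measurable_pi_apply i₀) (measurableSet_singleton (0 : ℂ)))] at hz
  refine measure_mono_null (fun x hx => ?_) hz
  have hle : Submodule.span ℂ (Set.range v) ≤ LinearMap.ker T.mulVecLin :=
    Submodule.span_le.2 (by rintro _ ⟨j, rfl⟩; exact hT0 j)
  exact congrFun (LinearMap.mem_ker.1 (hle hx)) i₀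

lemma measurableSet_linearIndependent (n : ℕ) :
    MeasurableSet {G : Fin n → Fin M → ℂ | LinearIndependent ℂ G} := by
  have h : {G : Fin n → Fin M → ℂ | LinearIndependent ℂ G} =
      {G | ((Matrix.of fun i j => G j i)ᴴ * (Matrix.of fun i j => G j i)).det ≠ 0} := by
    ext G
    exact linearIndependent_col_iff_det_ne_zero (Matrix.of fun i j => G j i)
  rw [h]
  have hc : Continuous fun G : Fin n → Fin M → ℂ => (fun i j => G j i : Fin M → Fin n → ℂ) := by
    fun_prop
  exact ((continuous_gram.comp hc).matrix_det.measurable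
    (measurableSet_singleton (0 : ℂ)).compl)

/-- At most `M` independent standard complex Gaussian vectors in `ℂ^M` are almost surely linearly
independent. -/
theorem ae_linearIndependent_pi_stdComplexGaussian (n : ℕ) (hn : n ≤ M) :
    ∀ᵐ G ∂(Measure.pi fun _ : Fin n => Measure.pi fun _ : Fin M => stdComplexGaussian),
      LinearIndependent ℂ G := by
  induction n with
  | zero => exact Filter.Eventually.of_forall fun G => linearIndependent_empty_type
  | succ n ih =>
    have hmp := (measurePreserving_piFinSuccAbove
      (fun _ : Fin (n + 1) => Measure.pi fun _ : Fin M => stdComplexGaussian) 0).symm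
    have hms := measurableSet_linearIndependent (M := M) (n + 1)
    rw [ae_iff, ← Set.compl_ofPred, ← hmp.measure_preimage hms.compl.nullMeasurableSet,
      Measure.prod_apply_symm (hmp.measurable hms.compl)]
    rw [lintegral_eq_zero_iff (measurable_measure_prodMk_right (hmp.measurable hms.compl))]
    -- With the remaining vectors frozen and independent, dependence forces the first one into their
    -- span.
    filter_upwards [ih (by omega)] with v hv
    refine measure_mono_null (fun x hx => ?_) (pi_stdComplexGaussian_span (by omega) v hv)
    by_contra hx'
    exact hx (linearIndependent_insertNth 0 x v hv hx')

/-- Law of the squared norm of a zero-forcing column of a standard complex Gaussian matrix. -/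
theorem pi_stdComplexGaussian_zfNormSq (n : ℕ) (hn : n < M) (k : Fin (n + 1)) {x : ℝ} (hx : 0 ≤ x) :
    (Measure.pi fun _ : Fin (n + 1) => Measure.pi fun _ : Fin M => stdComplexGaussian)
      {G | x * zfNormSq (Matrix.of fun i j => G j i) k ≤ 1} =
      ENNReal.ofReal (erlangTail (M - n) x) := by
  have hmp := (measurePreserving_piFinSuccAbove
    (fun _ : Fin (n + 1) => Measure.pi fun _ : Fin M => stdComplexGaussian) k).symm
  have hq : Measurable fun G : Fin (n + 1) → Fin M → ℂ =>
      zfNormSq (Matrix.of fun i j => G j i) k :=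
    (measurable_zfNormSq k).comp (f := fun G : Fin (n + 1) → Fin M → ℂ =>
      (fun i j => G j i : Fin M → Fin (n + 1) → ℂ)) (by fun_prop)
  have hms : MeasurableSet {G : Fin (n + 1) → Fin M → ℂ |
      x * zfNormSq (Matrix.of fun i j => G j i) k ≤ 1} :=
    measurableSet_le (hq.const_mul x) measurable_const
  rw [← hmp.measure_preimage hms.nullMeasurableSet, Measure.prod_apply_symm (hmp.measurable hms)]
  rw [lintegral_congr_ae (g := fun _ => ENNReal.ofReal (erlangTail (M - n) x)), lintegral_const,
    measure_univ, mul_one]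
  -- For almost every value of the n other columns, the conditional probability is the same Erlang
  -- tail, in the dimension M - n of their orthogonal complement.
  filter_upwards [ae_linearIndependent_pi_stdComplexGaussian n hn.le] with v hv
  obtain ⟨T, hT, hT0, hTp⟩ := exists_orthonormal_rows v hv
  obtain ⟨d, hd⟩ : ∃ d, M - n = d + 1 := ⟨M - n - 1, by omega⟩
  have key := map_mulVec_pi_stdComplexGaussian T hT
  have hms' : MeasurableSet {z : Fin (M - n) → ℂ | x ≤ ∑ i, ‖z i‖ ^ 2} :=
    measurableSet_le (by fun_prop) (by fun_prop)
  have htail : (Measure.pi fun _ : Fin (M - n) => stdComplexGaussian)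
      {z | x ≤ ∑ i, ‖z i‖ ^ 2} = ENNReal.ofReal (erlangTail (M - n) x) := by
    rw [hd]; exact pi_stdComplexGaussian_tail d hx
  rw [← htail, ← key, Measure.map_apply (by fun_prop) hms']
  refine measure_congr ?_
  filter_upwards [measure_eq_zero_iff_ae_notMem.1 (pi_stdComplexGaussian_span (by omega) v hv)] with w hw
  have hli := linearIndependent_insertNth k w v hv hw
  set G : Fin (n + 1) → Fin M → ℂ := Fin.insertNth (α := fun _ => Fin M → ℂ) k w v with hG
  have hcol : ∀ j, (Matrix.of fun i j => G j i).col j = G j := fun j => rfl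
  have hone := zfNormSq_mul_eq_one (Matrix.of fun i j => G j i) k
    ((linearIndependent_col_iff_det_ne_zero _).1 hli) T
    (fun j hj => by
      obtain ⟨j, rfl⟩ := Fin.exists_succAbove_eq hj
      rw [hcol, hG, Fin.insertNth_apply_succAbove, hT0])
    (fun a ha => hTp a fun j => by
      have := ha (k.succAbove j) (Fin.succAbove_ne k j)
      rwa [hcol, hG, Fin.insertNth_apply_succAbove] at this)
  rw [hcol, show G k = w by rw [hG, Fin.insertNth_apply_same]] at hone
  refine propext ?_
  change x * zfNormSq (Matrix.of fun i j => G j i) k ≤ 1 ↔ x ≤ ∑ i, ‖(T *ᵥ w) i‖ ^ 2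
  have hR : 0 ≤ ∑ i, ‖(T *ᵥ w) i‖ ^ 2 := by positivity
  have hR' : 0 < ∑ i, ‖(T *ᵥ w) i‖ ^ 2 := hR.lt_of_ne fun h => by
    rw [← h, mul_zero] at hone; exact zero_ne_one hone
  rw [eq_div_of_mul_eq hR'.ne' hone, mul_one_div, div_le_one hR']

end Law

/-! ### Conditional expectations and independence -/

section Probability

variable {Ω α β γ : Type*} [mΩ : MeasurableSpace Ω] [mα : MeasurableSpace α] [MeasurableSpace β]
  [MeasurableSpace γ] {μ : Measure Ω} [IsProbabilityMeasure μ]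

/-- Freezing lemma: conditioning on `Y` a function of `Y` and an independent `Z`. -/
theorem condLExp_comap_of_indepFun {Y : Ω → α} {Z : Ω → β} (hY : Measurable Y) (hZ : Measurable Z)
    (h : IndepFun Y Z μ) (f : α → β → ℝ≥0∞) (hf : Measurable (Function.uncurry f)) :
    condLExp (mα.comap Y) μ (fun ω => f (Y ω) (Z ω)) =ᵐ[μ]
      fun ω => ∫⁻ z, f (Y ω) z ∂(μ.map Z) := by
  have : IsProbabilityMeasure (μ.map Z) := Measure.isProbabilityMeasure_map hZ.aemeasurable
  have : IsProbabilityMeasure (μ.map Y) := Measure.isProbabilityMeasure_map hY.aemeasurable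
  have hg : Measurable fun y => ∫⁻ z, f y z ∂(μ.map Z) := hf.lintegral_prod_right'
  refine (ae_eq_condLExp hY.comap_le μ _ (hg.comp (comap_measurable Y)) ?_).symm
  -- On an event {Y ∈ s}, both integrals become integrals against the product of the laws of Y and
  -- Z, and Tonelli's theorem applies.
  rintro _ ⟨s, hs, rfl⟩
  have hprod := (indepFun_iff_map_prod_eq_prod_map_map hY.aemeasurable hZ.aemeasurable).1 h
  rw [← lintegral_indicator (hY hs), ← lintegral_indicator (hY hs)]
  have e1 : ∀ ω, (Y ⁻¹' s).indicator (fun ω => f (Y ω) (Z ω)) ω =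
      (fun p : α × β => (Prod.fst ⁻¹' s).indicator (Function.uncurry f) p) (Y ω, Z ω) := fun ω => by
    by_cases h : Y ω ∈ s <;> simp [h]
  have e2 : ∀ ω, (Y ⁻¹' s).indicator ((fun y => ∫⁻ z, f y z ∂(μ.map Z)) ∘ Y) ω =
      (fun y => s.indicator (fun y => ∫⁻ z, f y z ∂(μ.map Z)) y) (Y ω) := fun ω => by
    by_cases h : Y ω ∈ s <;> simp [h]
  have hm : Measurable (fun p : α × β => (Prod.fst ⁻¹' s).indicator (Function.uncurry f) p) :=
    hf.indicator (measurable_fst hs)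
  simp_rw [e1]
  refine (lintegral_congr e2).trans ?_
  rw [← lintegral_map hm (hY.prodMk hZ), hprod, lintegral_prod _ hm.aemeasurable,
    ← lintegral_map (hg.indicator hs) hY]
  refine lintegral_congr fun y => ?_
  by_cases hy : y ∈ s <;> simp [Set.indicator, hy]

lemma condLExp_finset_sum {ι : Type*} (m : MeasurableSpace Ω) (hm : m ≤ mΩ)
    (s : Finset ι) (f : ι → Ω → ℝ≥0∞) (hf : ∀ i ∈ s, Measurable[mΩ] (f i)) :
    condLExp m μ (fun ω => ∑ i ∈ s, f i ω) =ᵐ[μ] fun ω => ∑ i ∈ s, condLExp m μ (f i) ω := by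
  classical
  induction s using Finset.induction_on with
  | empty =>
    simp only [Finset.sum_empty]
    rw [condLExp_const hm μ 0]
  | insert a s ha ih =>
    simp only [Finset.sum_insert ha]
    have h1 := condLExp_add_left (P := μ) (mΩ := m) (X := f a) (fun ω => ∑ i ∈ s, f i ω)
      (hf a (Finset.mem_insert_self _ _)).aemeasurable
    filter_upwards [h1, ih fun i hi => hf i (Finset.mem_insert_of_mem hi)] with ω h1 h2
    rw [← h2]
    exact h1

/-- The joint law of the triple is a threefold product, which may be reassociated. -/
lemma IndepFun.prodMk_right_of_indepFun {X : Ω → α} {Y : Ω → β} {Z : Ω → γ} (hX : Measurable X)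
    (hY : Measurable Y) (hZ : Measurable Z) (hXY : IndepFun X Y μ)
    (h : IndepFun (fun ω => (X ω, Y ω)) Z μ) : IndepFun X (fun ω => (Y ω, Z ω)) μ := by
  have hYZ : IndepFun Y Z μ := h.comp measurable_snd measurable_id
  have p1 := (indepFun_iff_map_prod_eq_prod_map_map hX.aemeasurable hY.aemeasurable).1 hXY
  have p2 := (indepFun_iff_map_prod_eq_prod_map_map hY.aemeasurable hZ.aemeasurable).1 hYZ
  have p3 := (indepFun_iff_map_prod_eq_prod_map_map (hX.prodMk hY).aemeasurable
    hZ.aemeasurable).1 h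
  have : IsProbabilityMeasure (μ.map X) := Measure.isProbabilityMeasure_map hX.aemeasurable
  have : IsProbabilityMeasure (μ.map Y) := Measure.isProbabilityMeasure_map hY.aemeasurable
  have : IsProbabilityMeasure (μ.map Z) := Measure.isProbabilityMeasure_map hZ.aemeasurable
  rw [indepFun_iff_map_prod_eq_prod_map_map hX.aemeasurable (hY.prodMk hZ).aemeasurable, p2,
    ← (measurePreserving_prodAssoc (μ.map X) (μ.map Y) (μ.map Z)).map_eq, ← p1, ← p3,
    Measure.map_map (MeasurableEquiv.measurable _) ((hX.prodMk hY).prodMk hZ)]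
  rfl

end Probability

/-! ### Pilots, errors and noise as linear images of one Gaussian vector -/

namespace UplinkSystem

variable {L M K τ : ℕ} {Ω : Type*} (S : UplinkSystem L M K τ Ω)

/-- Variance `τ P ∑_j β_{j,k} + 1` of the entries of the projected pilots. -/
noncomputable def pilotVar (k : Fin K) : ℝ := τ * S.power * ∑ j, S.gain j k + 1

/-- Variance of the entries of the `k`-th column of the estimation error. -/
noncomputable def errorVar (i : Fin L) (k : Fin K) : ℝ :=
  S.gain i k - τ * S.power * S.gain i k ^ 2 / S.pilotVar k

/-- Coefficient of the MMSE estimate. -/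
noncomputable def mmseCoeff (i : Fin L) (k : Fin K) : ℝ :=
  Real.sqrt (τ * S.power) * S.gain i k / S.pilotVar k

/-- Index of the Gaussian family. -/
abbrev GaussianIndex (L M K τ : ℕ) := (Fin L × Fin M × Fin K) ⊕ (Fin M × Fin τ) ⊕ Fin M

/-- Rescaling of the rows by real factors that depend on the user only. -/
noncomputable def userScaling (K M : ℕ) (d : Fin K → ℝ) : Matrix (Fin K × Fin M) (Fin K × Fin M) ℂ :=
  Matrix.diagonal fun r => (d r.1 : ℂ)

lemma userScaling_mul (d e : Fin K → ℝ) :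
    userScaling K M d * userScaling K M e = userScaling K M fun k => d k * e k := by
  simp [userScaling, Matrix.diagonal_mul_diagonal]

lemma userScaling_sub (d e : Fin K → ℝ) :
    userScaling K M d - userScaling K M e = userScaling K M fun k => d k - e k := by
  simp [userScaling, Matrix.diagonal_sub]

lemma userScaling_conjTranspose (d : Fin K → ℝ) :
    (userScaling K M d)ᴴ = userScaling K M d := by
  rw [userScaling, Matrix.diagonal_conjTranspose]
  congr 1
  ext r
  simp

lemma userScaling_one : userScaling K M (fun _ => 1) = 1 := by
  simp [userScaling]

lemma userScaling_zero : userScaling K M (fun _ => 0) = 0 := by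
  simp [userScaling]

lemma userScaling_mulVec (d : Fin K → ℝ) (g : Fin K × Fin M → ℂ) (r : Fin K × Fin M) :
    (userScaling K M d *ᵥ g) r = d r.1 * g r := by
  rw [userScaling, Matrix.mulVec_diagonal]

/-- The linear map giving the entries of the projected pilots. -/
noncomputable def pilotMatrix : Matrix (Fin K × Fin M) (GaussianIndex L M K τ) ℂ :=
  Matrix.of fun r => Sum.elim
    (fun q => if q.2.1 = r.2 ∧ q.2.2 = r.1 then
      ((Real.sqrt (τ * S.power) * Real.sqrt (S.gain q.1 r.1) : ℝ) : ℂ) else 0)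
    (Sum.elim (fun q => if q.1 = r.2 then star (S.pilot q.2 r.1) else 0) (fun _ => 0))

/-- The linear map giving the entries of the fading matrix of cell `i`. -/
def fadingMatrix (L M K τ : ℕ) (i : Fin L) : Matrix (Fin K × Fin M) (GaussianIndex L M K τ) ℂ :=
  Matrix.of fun r => Sum.elim (fun q => if q.1 = i ∧ q.2.1 = r.2 ∧ q.2.2 = r.1 then 1 else 0)
    (fun _ => 0)

/-- The linear map giving the noise vector of the data phase. -/
def noiseMatrix (L M K τ : ℕ) : Matrix (Fin M) (GaussianIndex L M K τ) ℂ :=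
  Matrix.of fun r => Sum.elim (fun _ => 0) (Sum.elim (fun _ => 0) (fun m => if m = r then 1 else 0))

lemma pilotMatrix_mulVec (g : GaussianIndex L M K τ → ℂ) (r : Fin K × Fin M) :
    (S.pilotMatrix *ᵥ g) r =
      (Real.sqrt (τ * S.power) : ℂ) * ∑ i, (Real.sqrt (S.gain i r.1) : ℂ) *
        g (Sum.inl (i, r.2, r.1)) +
        ∑ t, star (S.pilot t r.1) * g (Sum.inr (Sum.inl (r.2, t))) := by
  simp only [pilotMatrix, Matrix.mulVec, dotProduct, Matrix.of_apply, Fintype.sum_sum_type,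
    Fintype.sum_prod_type, Sum.elim_inl, Sum.elim_inr, ite_mul, zero_mul, ite_and,
    Finset.sum_const_zero, add_zero]
  simp [Finset.mul_sum, mul_assoc, Finset.sum_ite_irrel]

lemma fadingMatrix_mulVec (i : Fin L) (g : GaussianIndex L M K τ → ℂ) (r : Fin K × Fin M) :
    (fadingMatrix L M K τ i *ᵥ g) r = g (Sum.inl (i, r.2, r.1)) := by
  simp only [fadingMatrix, Matrix.mulVec, dotProduct, Matrix.of_apply, Fintype.sum_sum_type,
    Fintype.sum_prod_type, Sum.elim_inl, Sum.elim_inr, ite_mul, zero_mul, ite_and]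
  simp [Finset.sum_ite_irrel]

lemma noiseMatrix_mulVec (g : GaussianIndex L M K τ → ℂ) (r : Fin M) :
    (noiseMatrix L M K τ *ᵥ g) r = g (Sum.inr (Sum.inr r)) := by
  simp [noiseMatrix, Matrix.mulVec, dotProduct]

lemma channel_apply (i : Fin L) (ω : Ω) (m : Fin M) (k : Fin K) :
    S.channel i ω m k = S.fading i ω m k * (Real.sqrt (S.gain i k) : ℂ) := by
  rw [channel, Matrix.mul_diagonal]

lemma projectedPilot_apply (hpil : S.pilotᴴ * S.pilot = 1) (ω : Ω) (m : Fin M) (k : Fin K) :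
    S.projectedPilot ω m k = (S.pilotMatrix *ᵥ fun s => S.gaussianFamily s ω) (k, m) := by
  have h1 : S.pilotᵀ * S.pilot.map star = 1 := by
    have := congrArg Matrix.transpose hpil
    rw [Matrix.transpose_mul, Matrix.transpose_one] at this
    exact this
  rw [pilotMatrix_mulVec, projectedPilot, receivedPilot, Matrix.add_mul, Matrix.smul_mul,
    Matrix.sum_mul]
  simp_rw [Matrix.mul_assoc, h1, Matrix.mul_one]
  simp [channel_apply, Matrix.sum_apply, Matrix.mul_apply, mul_comm, gaussianFamily]

variable {S}

lemma pilotVar_pos [MeasurableSpace Ω] {μ : Measure Ω} (hS : S.Model μ) (k : Fin K) :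
    0 < S.pilotVar k := by
  have h1 := hS.power_pos
  have h2 : 0 ≤ ∑ j, S.gain j k := Finset.sum_nonneg fun j _ => (hS.gain_pos j k).le
  unfold pilotVar
  positivity

/-- Since β_{i,k} ≤ ∑_j β_{j,k}, we have τPβ_{i,k}² < β_{i,k}(τP ∑_j β_{j,k} + 1). Positivity allows
the error entries to be normalised. -/
lemma errorVar_pos [MeasurableSpace Ω] {μ : Measure Ω} (hS : S.Model μ) (i : Fin L) (k : Fin K) :
    0 < S.errorVar i k := by
  have h0 := pilotVar_pos hS k
  have h1 := hS.power_pos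
  have h3 := hS.gain_pos i k
  have h2 : S.gain i k ≤ ∑ j, S.gain j k :=
    Finset.single_le_sum (f := fun j => S.gain j k) (fun j _ => (hS.gain_pos j k).le)
      (Finset.mem_univ i)
  unfold errorVar
  rw [sub_pos, div_lt_iff₀ h0, pilotVar]
  have h4 : τ * S.power * S.gain i k ≤ τ * S.power * ∑ j, S.gain j k :=
    mul_le_mul_of_nonneg_left h2 (by positivity)
  nlinarith

/-- Lets covariances be computed from the explicit `mulVec` formulas, applied to a conjugated row.
-/
lemma mul_conjTranspose_apply_eq_mulVec {κ κ' ι : Type*} [Fintype ι] (T : Matrix κ ι ℂ)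
    (T' : Matrix κ' ι ℂ) (r : κ) (r' : κ') : (T * T'ᴴ) r r' = (T *ᵥ fun s => star (T' r' s)) r := rfl

/-- Orthonormality of the pilots makes the projected noise white, so different users and antennas
are uncorrelated. -/
lemma pilotMatrix_mul_conjTranspose [MeasurableSpace Ω] {μ : Measure Ω} (hS : S.Model μ) :
    S.pilotMatrix * S.pilotMatrixᴴ = userScaling K M S.pilotVar := by
  have hP : (0 : ℝ) ≤ τ * S.power := mul_nonneg (Nat.cast_nonneg τ) hS.power_pos.le
  have hpil : ∀ k k', ∑ t, star (S.pilot t k) * S.pilot t k' = (1 : Matrix (Fin K) (Fin K) ℂ) k k' :=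
    fun k k' => by
      rw [← hS.pilot_orthonormal, Matrix.mul_apply]
      rfl
  ext ⟨k, m⟩ ⟨k', m'⟩
  rw [mul_conjTranspose_apply_eq_mulVec, pilotMatrix_mulVec, userScaling]
  by_cases hm : m = m'
  · subst hm
    by_cases hk : k = k'
    · subst hk
      simp only [pilotMatrix, Matrix.of_apply, Sum.elim_inl, Sum.elim_inr, and_self, if_true,
        star_star, hpil, Matrix.one_apply_eq, Matrix.diagonal_apply_eq, pilotVar]
      have h1 : ∀ i, (Real.sqrt (S.gain i k) : ℂ) *
          star ((Real.sqrt (τ * S.power) * Real.sqrt (S.gain i k) : ℝ) : ℂ) =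
          (Real.sqrt (τ * S.power) : ℂ) * S.gain i k := fun i => by
        have h2 : ((Real.sqrt (S.gain i k) * Real.sqrt (S.gain i k) : ℝ) : ℂ) = S.gain i k := by
          rw [Real.mul_self_sqrt (hS.gain_pos i k).le]
        rw [← h2, RCLike.star_def, Complex.conj_ofReal]
        push_cast
        ring
      have h3 : ((Real.sqrt (τ * S.power) * Real.sqrt (τ * S.power) : ℝ) : ℂ) =
          (τ * S.power : ℝ) := by
        rw [Real.mul_self_sqrt hP]
      simp_rw [h1]
      rw [← Finset.mul_sum, ← mul_assoc, ← Complex.ofReal_mul, h3]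
      push_cast
      rfl
    · have := hpil k k'
      rw [Matrix.one_apply_ne hk] at this
      simpa [pilotMatrix, hk] using this
  · simp [pilotMatrix, hm]

lemma fadingMatrix_mul_conjTranspose (i : Fin L) :
    fadingMatrix L M K τ i * (fadingMatrix L M K τ i)ᴴ = 1 := by
  ext ⟨k, m⟩ ⟨k', m'⟩
  rw [mul_conjTranspose_apply_eq_mulVec, fadingMatrix_mulVec, Matrix.one_apply]
  simp [fadingMatrix, and_comm]

lemma fadingMatrix_mul_pilotMatrix_conjTranspose (i : Fin L) :
    fadingMatrix L M K τ i * S.pilotMatrixᴴ = userScaling K M fun k =>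
      Real.sqrt (τ * S.power) * Real.sqrt (S.gain i k) := by
  ext ⟨k, m⟩ ⟨k', m'⟩
  rw [mul_conjTranspose_apply_eq_mulVec, fadingMatrix_mulVec, userScaling, Matrix.diagonal_apply]
  by_cases hk : k = k' <;> by_cases hm : m = m' <;> simp [pilotMatrix, hk, hm]

lemma noiseMatrix_mul_conjTranspose : noiseMatrix L M K τ * (noiseMatrix L M K τ)ᴴ = 1 := by
  ext m m'
  rw [mul_conjTranspose_apply_eq_mulVec, noiseMatrix_mulVec, Matrix.one_apply]
  simp [noiseMatrix]

lemma pilotMatrix_mul_noiseMatrix_conjTranspose :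
    S.pilotMatrix * (noiseMatrix L M K τ)ᴴ = 0 := by
  ext r m
  rw [mul_conjTranspose_apply_eq_mulVec, pilotMatrix_mulVec]
  simp [noiseMatrix]

/-- Entries of the projected pilots, normalised to unit variance. -/
noncomputable def normPilot (S : UplinkSystem L M K τ Ω) (ω : Ω) (r : Fin K × Fin M) : ℂ :=
  (Real.sqrt (S.pilotVar r.1) : ℂ)⁻¹ * S.projectedPilot ω r.2 r.1

/-- Entries of the estimation error, normalised to unit variance. -/
noncomputable def normError (S : UplinkSystem L M K τ Ω) (i : Fin L) (ω : Ω) (r : Fin K × Fin M) : ℂ :=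
  (Real.sqrt (S.errorVar i r.1) : ℂ)⁻¹ * S.estimationError i ω r.2 r.1

/-- The linear map giving the normalised projected pilots. -/
noncomputable def normPilotMatrix (S : UplinkSystem L M K τ Ω) :
    Matrix (Fin K × Fin M) (GaussianIndex L M K τ) ℂ :=
  userScaling K M (fun k => (Real.sqrt (S.pilotVar k))⁻¹) * S.pilotMatrix

/-- The linear map giving the normalised estimation error. -/
noncomputable def normErrorMatrix (S : UplinkSystem L M K τ Ω) (i : Fin L) :
    Matrix (Fin K × Fin M) (GaussianIndex L M K τ) ℂ :=
  userScaling K M (fun k => (Real.sqrt (S.errorVar i k))⁻¹) *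
    (userScaling K M (fun k => Real.sqrt (S.gain i k)) * fadingMatrix L M K τ i -
      userScaling K M (S.mmseCoeff i) * S.pilotMatrix)

lemma channelEstimate_apply (i : Fin L) (ω : Ω) (m : Fin M) (k : Fin K) :
    S.channelEstimate i ω m k = S.mmseCoeff i k * S.projectedPilot ω m k := by
  rw [channelEstimate, Matrix.mul_diagonal, mul_comm]
  rfl

lemma normPilotMatrix_mul_noiseMatrix_conjTranspose :
    S.normPilotMatrix * (noiseMatrix L M K τ)ᴴ = 0 := by
  rw [normPilotMatrix, Matrix.mul_assoc, pilotMatrix_mul_noiseMatrix_conjTranspose, Matrix.mul_zero]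

section Model

variable [MeasurableSpace Ω] {μ : Measure Ω}

lemma normPilot_eq (hS : S.Model μ) (ω : Ω) :
    S.normPilot ω = S.normPilotMatrix *ᵥ fun s => S.gaussianFamily s ω := by
  ext ⟨k, m⟩
  rw [normPilot, projectedPilot_apply S hS.pilot_orthonormal, normPilotMatrix, ← Matrix.mulVec_mulVec,
    userScaling_mulVec]
  simp

lemma normError_eq (hS : S.Model μ) (i : Fin L) (ω : Ω) :
    S.normError i ω = S.normErrorMatrix i *ᵥ fun s => S.gaussianFamily s ω := by
  ext ⟨k, m⟩
  rw [normError, normErrorMatrix, ← Matrix.mulVec_mulVec,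
    userScaling_mulVec, Matrix.sub_mulVec, ← Matrix.mulVec_mulVec, ← Matrix.mulVec_mulVec,
    Pi.sub_apply, userScaling_mulVec, userScaling_mulVec, fadingMatrix_mulVec,
    ← projectedPilot_apply S hS.pilot_orthonormal, estimationError, Matrix.sub_apply,
    channelEstimate_apply, channel_apply]
  simp [gaussianFamily, mul_comm]

lemma normPilotMatrix_mul_conjTranspose (hS : S.Model μ) :
    S.normPilotMatrix * S.normPilotMatrixᴴ = 1 := by
  have h : ∀ X D : Matrix (Fin K × Fin M) (Fin K × Fin M) ℂ,
    D * S.pilotMatrix * (S.pilotMatrixᴴ * X) = D * (S.pilotMatrix * S.pilotMatrixᴴ) * X :=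
    fun X D => by simp only [Matrix.mul_assoc]
  rw [normPilotMatrix, Matrix.conjTranspose_mul, h, pilotMatrix_mul_conjTranspose hS,
    userScaling_conjTranspose, userScaling_mul, userScaling_mul, ← userScaling_one]
  congr 1
  ext k
  have h0 := pilotVar_pos hS k
  rw [mul_right_comm, ← mul_inv, Real.mul_self_sqrt h0.le, inv_mul_cancel₀ h0.ne']

/-- Orthogonality principle: the MMSE coefficient is the covariance of channel and pilot divided by
the pilot variance, so the residual is uncorrelated with the pilots. -/
lemma normErrorMatrix_mul_normPilotMatrix_conjTranspose (hS : S.Model μ) (i : Fin L) :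
    S.normErrorMatrix i * S.normPilotMatrixᴴ = 0 := by
  have h : ∀ X B C D : Matrix (Fin K × Fin M) (Fin K × Fin M) ℂ,
      D * (B * fadingMatrix L M K τ i - C * S.pilotMatrix) * (S.pilotMatrixᴴ * X) =
        D * (B * (fadingMatrix L M K τ i * S.pilotMatrixᴴ) -
          C * (S.pilotMatrix * S.pilotMatrixᴴ)) * X := fun X B C D => by
    simp only [Matrix.mul_assoc, Matrix.sub_mul, Matrix.mul_sub]
  rw [normErrorMatrix, normPilotMatrix, Matrix.conjTranspose_mul, h,
    pilotMatrix_mul_conjTranspose hS, fadingMatrix_mul_pilotMatrix_conjTranspose,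
    userScaling_mul, userScaling_mul, userScaling_sub]
  have h0 : (fun k => Real.sqrt (S.gain i k) * (Real.sqrt (τ * S.power) * Real.sqrt (S.gain i k)) -
      S.mmseCoeff i k * S.pilotVar k) = fun _ => 0 := by
    ext k
    have h0 := pilotVar_pos hS k
    rw [mmseCoeff, div_mul_cancel₀ _ h0.ne', mul_left_comm,
      Real.mul_self_sqrt (hS.gain_pos i k).le, sub_self]
  rw [h0, userScaling_zero, Matrix.mul_zero, Matrix.zero_mul]

lemma normErrorMatrix_mul_conjTranspose (hS : S.Model μ) (i : Fin L) :
    S.normErrorMatrix i * (S.normErrorMatrix i)ᴴ = 1 := by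
  have hP : (0 : ℝ) ≤ τ * S.power := mul_nonneg (Nat.cast_nonneg τ) hS.power_pos.le
  have h : ∀ B C D : Matrix (Fin K × Fin M) (Fin K × Fin M) ℂ,
      D * (B * fadingMatrix L M K τ i - C * S.pilotMatrix) *
        (((fadingMatrix L M K τ i)ᴴ * B - S.pilotMatrixᴴ * C) * D) =
        D * ((B * (fadingMatrix L M K τ i * (fadingMatrix L M K τ i)ᴴ) * B -
          C * (fadingMatrix L M K τ i * S.pilotMatrixᴴ)ᴴ * B) -
          (B * (fadingMatrix L M K τ i * S.pilotMatrixᴴ) * C -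
          C * (S.pilotMatrix * S.pilotMatrixᴴ) * C)) * D := fun B C D => by
    simp only [Matrix.mul_assoc, Matrix.sub_mul, Matrix.mul_sub, Matrix.conjTranspose_mul,
      Matrix.conjTranspose_conjTranspose]
  rw [normErrorMatrix, Matrix.conjTranspose_mul, Matrix.conjTranspose_sub,
    Matrix.conjTranspose_mul, Matrix.conjTranspose_mul]
  simp only [userScaling_conjTranspose]
  rw [h, pilotMatrix_mul_conjTranspose hS, fadingMatrix_mul_pilotMatrix_conjTranspose,
    fadingMatrix_mul_conjTranspose, Matrix.mul_one, userScaling_conjTranspose]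
  simp only [userScaling_mul, userScaling_sub]
  rw [← userScaling_one]
  congr 1
  ext k
  have h0 := pilotVar_pos hS k
  have h1 := errorVar_pos hS i k
  -- Variance of channel minus c times pilot, with c the MMSE coefficient: the term in c² cancels
  -- one of the two equal cross terms.
  have h2 : Real.sqrt (S.gain i k) * Real.sqrt (S.gain i k) -
      S.mmseCoeff i k * (Real.sqrt (τ * S.power) * Real.sqrt (S.gain i k)) * Real.sqrt (S.gain i k) -
      (Real.sqrt (S.gain i k) * (Real.sqrt (τ * S.power) * Real.sqrt (S.gain i k)) *
        S.mmseCoeff i k - S.mmseCoeff i k * S.pilotVar k * S.mmseCoeff i k) = S.errorVar i k := by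
    have e1 := Real.mul_self_sqrt (hS.gain_pos i k).le
    have e2 := Real.mul_self_sqrt hP
    have e3 : S.mmseCoeff i k * S.pilotVar k = Real.sqrt (τ * S.power) * S.gain i k :=
      div_mul_cancel₀ _ h0.ne'
    have e4 : S.errorVar i k = S.gain i k - Real.sqrt (τ * S.power) * S.gain i k * S.mmseCoeff i k := by
      rw [errorVar, mmseCoeff]
      nth_rewrite 1 [← e2]
      ring
    rw [e3, e4]
    linear_combination (1 - 2 * S.mmseCoeff i k * Real.sqrt (τ * S.power)) * e1
  rw [h2, mul_right_comm, ← mul_inv, Real.mul_self_sqrt h1.le, inv_mul_cancel₀ h1.ne']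

end Model

end UplinkSystem

/-! ### Auxiliary facts on products, second moments and zero forcing -/

lemma map_curry_pi_stdComplexGaussian (ι κ : Type*) [Fintype ι] [Fintype κ] :
    (Measure.pi fun _ : ι × κ => stdComplexGaussian).map (fun g i j => g (i, j)) =
      Measure.pi fun _ : ι => Measure.pi fun _ : κ => stdComplexGaussian := by
  have h := Measure.infinitePi_map_curry (fun (_ : ι) (_ : κ) => stdComplexGaussian)
  simp only [Measure.infinitePi_eq_pi] at h
  exact h

/-- Integrability need not be assumed: the Bochner integral of a non-integrable function is 0, so
the value 1 forces it. -/
lemma lintegral_enorm_sq_eq_one {Ω : Type*} [MeasurableSpace Ω] {μ : Measure Ω} (f : Ω → ℂ)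
    (h : ∫ ω, f ω * star (f ω) ∂μ = 1) : ∫⁻ ω, ‖f ω‖ₑ ^ 2 ∂μ = 1 := by
  have hf : ∀ ω, f ω * star (f ω) = ((‖f ω‖ ^ 2 : ℝ) : ℂ) := fun ω => by
    rw [RCLike.star_def, Complex.mul_conj, Complex.normSq_eq_norm_sq]
  simp_rw [hf] at h
  rw [integral_complex_ofReal] at h
  have h' : ∫ ω, ‖f ω‖ ^ 2 ∂μ = 1 := by exact_mod_cast h
  have hint : Integrable (fun ω => ‖f ω‖ ^ 2) μ := by
    by_contra hn
    rw [integral_undef hn] at h'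
    exact zero_ne_one h'
  have := ofReal_integral_eq_lintegral_ofReal hint (Filter.Eventually.of_forall fun _ => by positivity)
  rw [h', ENNReal.ofReal_one] at this
  rw [this]
  refine lintegral_congr fun ω => ?_
  rw [ENNReal.ofReal_pow (norm_nonneg _), ofReal_norm]

section ZeroForcing

variable {m κ : Type*} [Fintype m] [Fintype κ] [DecidableEq κ]

lemma zfMatrix_conjTranspose_mul (W : Matrix m κ ℂ) (hW : (Wᴴ * W).det ≠ 0) :
    (W * (Wᴴ * W)⁻¹)ᴴ * W = 1 := by
  rw [Matrix.conjTranspose_mul, Matrix.conjTranspose_nonsing_inv, Matrix.conjTranspose_mul,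
    Matrix.conjTranspose_conjTranspose, Matrix.mul_assoc,
    Matrix.nonsing_inv_mul _ (isUnit_iff_ne_zero.2 hW)]

lemma zfNormSq_pos (W : Matrix m κ ℂ) (hW : (Wᴴ * W).det ≠ 0) (k : κ) : 0 < zfNormSq W k := by
  have h0 : 0 ≤ zfNormSq W k := by unfold zfNormSq; positivity
  refine h0.lt_of_ne fun h => ?_
  have h1 : ∀ i, (W * (Wᴴ * W)⁻¹) i k = 0 := fun i => by
    have := (Finset.sum_eq_zero_iff_of_nonneg (fun i _ => by positivity)).1 h.symm i
      (Finset.mem_univ i)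
    simpa using this
  have h2 := congrFun (congrFun (zfMatrix_conjTranspose_mul W hW) k) k
  rw [Matrix.mul_apply] at h2
  simp [Matrix.conjTranspose_apply, h1] at h2

end ZeroForcing

/-! ### Joint laws of estimate, error, noise and symbols -/

namespace UplinkSystem

variable {L M K τ : ℕ} {Ω : Type*} {S : UplinkSystem L M K τ Ω} [MeasurableSpace Ω] {μ : Measure Ω}

lemma measurable_gaussianFamily (hS : S.Model μ) :
    Measurable fun ω s => S.gaussianFamily s ω := measurable_pi_lambda _ hS.measurable_gaussian

lemma measurable_normPilot (hS : S.Model μ) : Measurable S.normPilot := by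
  have h : S.normPilot = fun ω => S.normPilotMatrix *ᵥ fun s => S.gaussianFamily s ω :=
    funext (normPilot_eq hS)
  rw [h]
  exact Measurable.comp (g := fun g => S.normPilotMatrix *ᵥ g) (by fun_prop)
    (measurable_gaussianFamily hS)

lemma measurable_normError (hS : S.Model μ) (i : Fin L) : Measurable (S.normError i) := by
  have h : S.normError i = fun ω => S.normErrorMatrix i *ᵥ fun s => S.gaussianFamily s ω :=
    funext (normError_eq hS i)
  rw [h]
  exact Measurable.comp (g := fun g => S.normErrorMatrix i *ᵥ g) (by fun_prop)
    (measurable_gaussianFamily hS)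

lemma measurable_noise (hS : S.Model μ) : Measurable S.noise :=
  measurable_pi_lambda _ fun m => hS.measurable_gaussian (Sum.inr (Sum.inr m))

lemma measurable_symbol (hS : S.Model μ) (i : Fin L) : Measurable (S.symbol i) :=
  measurable_pi_lambda _ fun k => hS.measurable_symbol i k

lemma estimationError_apply (hS : S.Model μ) (i : Fin L) (ω : Ω) (m : Fin M) (k : Fin K) :
    S.estimationError i ω m k = Real.sqrt (S.errorVar i k) * S.normError i ω (k, m) := by
  have h : (Real.sqrt (S.errorVar i k) : ℂ) ≠ 0 := by
    exact_mod_cast (Real.sqrt_pos.2 (errorVar_pos hS i k)).ne'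
  rw [normError, mul_inv_cancel_left₀ h]

/-- An empty pilot matrix would give Ψ†Ψ = 0, which is not the identity once a user exists. -/
lemma pilot_length_pos (hS : S.Model μ) (k : Fin K) : 0 < τ := by
  rcases Nat.eq_zero_or_pos τ with rfl | h
  · have := congrFun (congrFun hS.pilot_orthonormal k) k
    simp [Matrix.mul_apply] at this
  · exact h

lemma mmseCoeff_pos (hS : S.Model μ) (i : Fin L) (k : Fin K) : 0 < S.mmseCoeff i k := by
  have h1 := pilotVar_pos hS k
  have h2 := hS.gain_pos i k
  have h3 : (0 : ℝ) < τ := Nat.cast_pos.2 (pilot_length_pos hS k)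
  have h4 := hS.power_pos
  unfold mmseCoeff
  positivity

/-- Standard deviation of the entries of the `k`-th column of the estimate of the own channel. -/
noncomputable def estimateScale (S : UplinkSystem L M K τ Ω) (k : Fin K) : ℝ :=
  S.mmseCoeff S.cell k * Real.sqrt (S.pilotVar k)

lemma estimateScale_pos (hS : S.Model μ) (k : Fin K) : 0 < S.estimateScale k :=
  mul_pos (mmseCoeff_pos hS _ k) (Real.sqrt_pos.2 (pilotVar_pos hS k))

lemma channelEstimate_cell_eq (hS : S.Model μ) (ω : Ω) :
    S.channelEstimate S.cell ω = (Matrix.of fun m k => S.normPilot ω (k, m)) *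
      Matrix.diagonal fun k => (S.estimateScale k : ℂ) := by
  ext m k
  have h : (Real.sqrt (S.pilotVar k) : ℂ) ≠ 0 := by
    exact_mod_cast (Real.sqrt_pos.2 (pilotVar_pos hS k)).ne'
  rw [Matrix.mul_diagonal, channelEstimate_apply, Matrix.of_apply, normPilot, estimateScale]
  push_cast
  field_simp

lemma measurable_channelEstimate (hS : S.Model μ) :
    Measurable fun ω (m : Fin M) (k : Fin K) => S.channelEstimate S.cell ω m k := by
  have h := measurable_normPilot hS
  simp only [channelEstimate_cell_eq hS, Matrix.mul_diagonal, Matrix.of_apply]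
  fun_prop

/-- A random variable that is independent of the projected pilots is independent of the channel
estimate. -/
lemma indepFun_channelEstimate (hS : S.Model μ) {β : Type*} [MeasurableSpace β] {Z : Ω → β}
    (h : IndepFun S.normPilot Z μ) :
    IndepFun (fun ω (m : Fin M) (k : Fin K) => S.channelEstimate S.cell ω m k) Z μ := by
  have hc := h.comp (φ := fun (g : Fin K × Fin M → ℂ) (m : Fin M) (k : Fin K) =>
    g (k, m) * (S.estimateScale k : ℂ)) (ψ := id) (by fun_prop) measurable_id
  have he : (fun ω (m : Fin M) (k : Fin K) => S.channelEstimate S.cell ω m k) =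
      (fun (g : Fin K × Fin M → ℂ) (m : Fin M) (k : Fin K) =>
        g (k, m) * (S.estimateScale k : ℂ)) ∘ S.normPilot := by
    ext ω m k
    rw [channelEstimate_cell_eq hS, Matrix.mul_diagonal]
    rfl
  rw [he]
  exact hc

variable [IsProbabilityMeasure μ]

lemma map_gaussianFamily (hS : S.Model μ) :
    μ.map (fun ω s => S.gaussianFamily s ω) = Measure.pi fun _ => stdComplexGaussian := by
  have h := (iIndepFun_iff_map_fun_eq_pi_map
    (fun s => (hS.measurable_gaussian s).aemeasurable)).1 hS.indep_gaussian
  rw [h]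
  congr 1
  ext1 s
  exact hS.law_gaussian s

/-- Uncorrelated linear images of a Gaussian vector are independent. -/
lemma map_mulVec_gaussianFamily (hS : S.Model μ) {κ κ' : Type*} [Fintype κ] [Fintype κ']
    [DecidableEq κ] [DecidableEq κ'] (T : Matrix κ (GaussianIndex L M K τ) ℂ)
    (T' : Matrix κ' (GaussianIndex L M K τ) ℂ) (hT : T * Tᴴ = 1) (hT' : T' * T'ᴴ = 1)
    (h : T * T'ᴴ = 0) {X : Ω → κ → ℂ} {Y : Ω → κ' → ℂ}
    (hX : ∀ ω, X ω = T *ᵥ fun s => S.gaussianFamily s ω)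
    (hY : ∀ ω, Y ω = T' *ᵥ fun s => S.gaussianFamily s ω) :
    μ.map X = (Measure.pi fun _ : κ => stdComplexGaussian) ∧
    μ.map Y = (Measure.pi fun _ : κ' => stdComplexGaussian) ∧ IndepFun X Y μ := by
  have hg := measurable_gaussianFamily hS
  obtain rfl : X = fun ω => T *ᵥ fun s => S.gaussianFamily s ω := funext hX
  obtain rfl : Y = fun ω => T' *ᵥ fun s => S.gaussianFamily s ω := funext hY
  have hm : Measurable fun x : GaussianIndex L M K τ → ℂ => T *ᵥ x := by fun_prop
  have hm' : Measurable fun x : GaussianIndex L M K τ → ℂ => T' *ᵥ x := by fun_prop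
  have h1 : μ.map (fun ω => T *ᵥ fun s => S.gaussianFamily s ω) =
      (Measure.pi fun _ : κ => stdComplexGaussian) := by
    rw [← map_mulVec_pi_stdComplexGaussian T hT, ← map_gaussianFamily hS, Measure.map_map hm hg]
    rfl
  have h2 : μ.map (fun ω => T' *ᵥ fun s => S.gaussianFamily s ω) =
      (Measure.pi fun _ : κ' => stdComplexGaussian) := by
    rw [← map_mulVec_pi_stdComplexGaussian T' hT', ← map_gaussianFamily hS, Measure.map_map hm' hg]
    rfl
  refine ⟨h1, h2, ?_⟩
  refine (indepFun_iff_map_prod_eq_prod_map_map (hm.comp hg).aemeasurable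
    (hm'.comp hg).aemeasurable).2 ?_
  simp only [Function.comp_def]
  rw [h1, h2, ← map_mulVec_prod_pi_stdComplexGaussian T T' hT hT' h, ← map_gaussianFamily hS,
    Measure.map_map (hm.prodMk hm') hg]
  rfl

lemma law_normPilot_normError (hS : S.Model μ) (i : Fin L) :
    μ.map S.normPilot = (Measure.pi fun _ => stdComplexGaussian) ∧
    μ.map (S.normError i) = (Measure.pi fun _ => stdComplexGaussian) ∧
    IndepFun S.normPilot (S.normError i) μ := by
  refine map_mulVec_gaussianFamily hS S.normPilotMatrix (S.normErrorMatrix i)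
    (normPilotMatrix_mul_conjTranspose hS) (normErrorMatrix_mul_conjTranspose hS i) ?_
    (normPilot_eq hS) (normError_eq hS i)
  have h := congrArg Matrix.conjTranspose (normErrorMatrix_mul_normPilotMatrix_conjTranspose hS i)
  simpa using h

lemma law_normPilot_noise (hS : S.Model μ) :
    μ.map S.normPilot = (Measure.pi fun _ => stdComplexGaussian) ∧
    μ.map S.noise = (Measure.pi fun _ => stdComplexGaussian) ∧
    IndepFun S.normPilot S.noise μ := by
  refine map_mulVec_gaussianFamily hS S.normPilotMatrix (noiseMatrix L M K τ)
    (normPilotMatrix_mul_conjTranspose hS) noiseMatrix_mul_conjTranspose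
    normPilotMatrix_mul_noiseMatrix_conjTranspose (normPilot_eq hS) fun ω => ?_
  ext m
  rw [noiseMatrix_mulVec]
  rfl

/-- The symbols are independent of the whole Gaussian family, hence of pilots and error jointly;
pairwise independence would not suffice. -/
lemma indepFun_normPilot_prod (hS : S.Model μ) (i : Fin L) :
    IndepFun S.normPilot (fun ω => (S.normError i ω, S.symbol i ω)) μ ∧
      μ.map (fun ω => (S.normError i ω, S.symbol i ω)) =
        (Measure.pi fun _ => stdComplexGaussian).prod (μ.map (S.symbol i)) := by
  obtain ⟨-, h2, h3⟩ := law_normPilot_normError hS i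
  have hsym : IndepFun (fun ω => (S.normPilot ω, S.normError i ω)) (S.symbol i) μ := by
    have h := hS.indep_symbol.symm
    have hi : Measurable fun x : Fin L → Fin K → ℂ => x i := measurable_pi_apply i
    have hc := h.comp (φ := fun g : GaussianIndex L M K τ → ℂ =>
      (S.normPilotMatrix *ᵥ g, S.normErrorMatrix i *ᵥ g)) (ψ := fun x : Fin L → Fin K → ℂ => x i)
      (by fun_prop) hi
    have he : (fun ω => (S.normPilot ω, S.normError i ω)) =
        (fun g : GaussianIndex L M K τ → ℂ => (S.normPilotMatrix *ᵥ g, S.normErrorMatrix i *ᵥ g)) ∘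
          fun ω s => S.gaussianFamily s ω := by
      ext ω : 1
      rw [normPilot_eq hS, normError_eq hS]
      rfl
    rw [he]
    exact hc
  refine ⟨IndepFun.prodMk_right_of_indepFun (measurable_normPilot hS) (measurable_normError hS i)
    (measurable_symbol hS i) h3 hsym, ?_⟩
  rw [← h2]
  exact (indepFun_iff_map_prod_eq_prod_map_map (measurable_normError hS i).aemeasurable
    (measurable_symbol hS i).aemeasurable).1 (hsym.comp measurable_snd measurable_id)

/-- Mean power of the estimation error, in terms of the variances of its entries. -/
lemma errorPower_eq (hS : S.Model μ) (hM : 0 < M) (i : Fin L) :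
    S.errorPower μ i = ∑ j, S.errorVar i j := by
  have hE := (law_normPilot_normError hS i).2.1
  have hEm := measurable_normError hS i
  have hmom : ∀ r, ∫⁻ ω, ‖S.normError i ω r‖ₑ ^ 2 ∂μ = 1 := fun r => by
    have h1 := (measurePreserving_eval (fun _ : Fin K × Fin M => stdComplexGaussian) r)
    rw [← lintegral_map (f := fun g : Fin K × Fin M → ℂ => ‖g r‖ₑ ^ 2) (by fun_prop) hEm, hE,
      ← lintegral_enorm_sq_stdComplexGaussian]
    exact h1.lintegral_comp (f := fun z : ℂ => ‖z‖ₑ ^ 2) (by fun_prop)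
  have hint : ∀ r, Integrable (fun ω => ‖S.normError i ω r‖ ^ 2) μ ∧
      ∫ ω, ‖S.normError i ω r‖ ^ 2 ∂μ = 1 := fun r => by
    have hr : Measurable fun ω => S.normError i ω r := (measurable_pi_apply r).comp hEm
    have h1 : ∀ ω, ENNReal.ofReal (‖S.normError i ω r‖ ^ 2) = ‖S.normError i ω r‖ₑ ^ 2 := fun ω => by
      rw [ENNReal.ofReal_pow (norm_nonneg _), ofReal_norm]
    refine ⟨⟨by fun_prop, ?_⟩, ?_⟩
    · rw [hasFiniteIntegral_iff_ofReal (Filter.Eventually.of_forall fun _ => by positivity)]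
      simp_rw [h1, hmom]
      exact ENNReal.one_lt_top
    · rw [integral_eq_lintegral_of_nonneg_ae (Filter.Eventually.of_forall fun _ => by positivity)
        (by fun_prop)]
      simp_rw [h1, hmom]
      rfl
  have hdiag : ∀ m : Fin M, ∫ ω, (S.estimationError i ω * (S.estimationError i ω)ᴴ) m m ∂μ =
      ((∑ j, S.errorVar i j : ℝ) : ℂ) := fun m => by
    have h1 : ∀ ω, (S.estimationError i ω * (S.estimationError i ω)ᴴ) m m =
        ((∑ j, S.errorVar i j * ‖S.normError i ω (j, m)‖ ^ 2 : ℝ) : ℂ) := fun ω => by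
      rw [Matrix.mul_apply, Complex.ofReal_sum]
      refine Finset.sum_congr rfl fun j _ => ?_
      rw [Matrix.conjTranspose_apply, RCLike.star_def, Complex.mul_conj, Complex.normSq_eq_norm_sq,
        estimationError_apply hS, norm_mul, mul_pow]
      congr 2
      rw [Complex.norm_real, Real.norm_eq_abs, sq_abs, Real.sq_sqrt (errorVar_pos hS i j).le]
    simp_rw [h1]
    rw [integral_complex_ofReal, integral_finsetSum _ fun j _ => (hint (j, m)).1.const_mul _]
    simp_rw [integral_const_mul, (hint _).2, mul_one]
  rw [errorPower, Matrix.trace]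
  simp only [Matrix.diag_apply, Matrix.of_apply, hdiag, Finset.sum_const, Finset.card_univ,
    Fintype.card_fin, nsmul_eq_mul]
  have : (M : ℝ) ≠ 0 := by positivity
  rw [← Complex.ofReal_natCast, ← Complex.ofReal_mul, Complex.ofReal_re]
  field_simp

lemma ae_channelEstimate_det_ne_zero (hS : S.Model μ) (hKM : K ≤ M) :
    ∀ᵐ ω ∂μ, ((S.channelEstimate S.cell ω)ᴴ * S.channelEstimate S.cell ω).det ≠ 0 := by
  have hP := (law_normPilot_normError hS S.cell).1
  have hc := map_curry_pi_stdComplexGaussian (Fin K) (Fin M)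
  rw [← hP, Measure.map_map (by fun_prop) (measurable_normPilot hS)] at hc
  have h := ae_linearIndependent_pi_stdComplexGaussian (M := M) K hKM
  rw [← hc, ae_map_iff ((Measurable.comp (by fun_prop) (measurable_normPilot hS)).aemeasurable)
    (measurableSet_linearIndependent K)] at h
  filter_upwards [h] with ω hω
  have hdet : ((Matrix.of fun m k => S.normPilot ω (k, m))ᴴ *
      (Matrix.of fun m k => S.normPilot ω (k, m))).det ≠ 0 :=
    (linearIndependent_col_iff_det_ne_zero (Matrix.of fun m k => S.normPilot ω (k, m))).1 hω
  rw [channelEstimate_cell_eq hS, Matrix.conjTranspose_mul, Matrix.mul_assoc,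
    ← Matrix.mul_assoc (Matrix.of _)ᴴ, Matrix.det_mul, Matrix.det_mul, Matrix.diagonal_conjTranspose,
    Matrix.det_diagonal, Matrix.det_diagonal]
  refine mul_ne_zero (Finset.prod_ne_zero_iff.2 fun k _ => ?_) (mul_ne_zero hdet
    (Finset.prod_ne_zero_iff.2 fun k _ => ?_))
  · rw [Pi.star_apply, star_ne_zero]
    exact_mod_cast (estimateScale_pos hS k).ne'
  · exact_mod_cast (estimateScale_pos hS k).ne'

end UplinkSystem

/-! ### Conditional interference power -/

lemma enorm_real_sq (b : ℝ) : ‖(b : ℂ)‖ₑ ^ 2 = ENNReal.ofReal (b ^ 2) := by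
  rw [← ofReal_norm, ← ENNReal.ofReal_pow (norm_nonneg _), Complex.norm_real, Real.norm_eq_abs,
    sq_abs]

lemma enorm_complex_star (z : ℂ) : ‖star z‖ₑ = ‖z‖ₑ := by
  rw [← ofReal_norm, norm_star, ofReal_norm]

namespace UplinkSystem

variable {L M K τ : ℕ} {Ω : Type*} {S : UplinkSystem L M K τ Ω}

/-- The signal `a† ξ x + b x_k` seen by a receiver `a` when the channel is the sum of the estimation
error `ξ` (with normalised entries `z`) and of a part that `a` maps to `b e_k†`. -/
noncomputable def streamSignal (S : UplinkSystem L M K τ Ω) (i : Fin L) (k : Fin K) (b : ℝ)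
    (a : Fin M → ℂ) (z : Fin K × Fin M → ℂ) (x : Fin K → ℂ) : ℂ :=
  ∑ m, star (a m) * ∑ j, (Real.sqrt (S.errorVar i j) : ℂ) * z (j, m) * x j + b * x k

lemma streamSignal_eq_dotProduct (i : Fin L) (k : Fin K) (b : ℝ)
    (a : Fin M → ℂ) (z : Fin K × Fin M → ℂ) (x : Fin K → ℂ) :
    S.streamSignal i k b a z x = (fun r : Fin K × Fin M =>
      star (a r.2) * (Real.sqrt (S.errorVar i r.1) : ℂ) * x r.1) ⬝ᵥ z + b * x k := by
  rw [streamSignal, dotProduct, Fintype.sum_prod_type, Finset.sum_comm]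
  congr 1
  refine Finset.sum_congr rfl fun m _ => ?_
  rw [Finset.mul_sum]
  refine Finset.sum_congr rfl fun j _ => ?_
  ring

variable [MeasurableSpace Ω] {μ : Measure Ω}

/-- Covers both kinds of interference: G = 0, b = 0 for the own cell, and G = Ĝ_i, b =
β_{i,k}/β_{ℓ,k} for the others. -/
lemma mulVec_error_add (hS : S.Model μ) (i : Fin L) (k : Fin K) (b : ℝ) (ω : Ω)
    (G : Matrix (Fin M) (Fin K) ℂ) (hG : ((S.zfReceiver ω)ᴴ * G) k = Pi.single k (b : ℂ)) :
    ((S.zfReceiver ω)ᴴ *ᵥ ((G + S.estimationError i ω) *ᵥ S.symbol i ω)) k =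
      S.streamSignal i k b (fun m => S.zfReceiver ω m k) (S.normError i ω) (S.symbol i ω) := by
  rw [Matrix.add_mulVec, Matrix.mulVec_add, Pi.add_apply, Matrix.mulVec_mulVec, add_comm,
    streamSignal]
  congr 1
  · simp only [Matrix.mulVec, dotProduct, Matrix.conjTranspose_apply, estimationError_apply hS]
  · simp only [Matrix.mulVec, hG, single_dotProduct]

/-- The power `∑_m |a_{m,k}|²` of the `k`-th column of the zero-forcing receiver. -/
noncomputable def zfPower (S : UplinkSystem L M K τ Ω) (k : Fin K) (ω : Ω) : ℝ≥0∞ :=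
  ∑ m, ‖S.zfReceiver ω m k‖ₑ ^ 2

/-- Pilot contamination: all estimates are column rescalings of the same projected pilots. -/
lemma channelEstimate_eq_cell_mul (hS : S.Model μ) (i : Fin L) (ω : Ω) :
    S.channelEstimate i ω = S.channelEstimate S.cell ω *
      Matrix.diagonal fun j => ((S.gain i j / S.gain S.cell j : ℝ) : ℂ) := by
  ext m j
  rw [Matrix.mul_diagonal, channelEstimate_apply, channelEstimate_apply, mul_right_comm,
    ← Complex.ofReal_mul]
  congr 2
  have h1 := hS.gain_pos S.cell j
  rw [mmseCoeff, mmseCoeff]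
  field_simp

lemma zfPower_eq (hS : S.Model μ) (k : Fin K) (ω : Ω) : S.zfPower k ω =
    ENNReal.ofReal (zfNormSq (Matrix.of fun m k => S.normPilot ω (k, m)) k /
      S.estimateScale k ^ 2) := by
  have h1 : ∀ m, S.zfReceiver ω m k = ((Matrix.of fun m k => S.normPilot ω (k, m)) *
      ((Matrix.of fun m k => S.normPilot ω (k, m))ᴴ *
        (Matrix.of fun m k => S.normPilot ω (k, m)))⁻¹) m k * ((S.estimateScale k : ℂ))⁻¹ :=
    fun m => by
      rw [zfReceiver, channelEstimate_cell_eq hS, zfMatrix_mul_diagonal, Matrix.mul_diagonal]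
      · intro k
        exact_mod_cast (estimateScale_pos hS k).ne'
      · intro k
        simp
  rw [zfPower, zfNormSq, Finset.sum_div, ENNReal.ofReal_sum_of_nonneg fun _ _ => by positivity]
  refine Finset.sum_congr rfl fun m _ => ?_
  rw [h1, ← ofReal_norm, ← ENNReal.ofReal_pow (norm_nonneg _), norm_mul, mul_pow, norm_inv,
    Complex.norm_real, Real.norm_eq_abs, inv_pow, sq_abs, div_eq_mul_inv]

/-- Origin of the factor β̂_k/β_{ℓ,k}² in θ. -/
lemma estimateScale_sq (hS : S.Model μ) (k : Fin K) :
    S.estimateScale k ^ 2 = S.gain S.cell k ^ 2 / S.betaHat k := by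
  have h1 := pilotVar_pos hS k
  have h3 : (0 : ℝ) < τ := Nat.cast_pos.2 (pilot_length_pos hS k)
  have h4 := hS.power_pos
  have h5 : S.betaHat k = S.pilotVar k / (τ * S.power) := by
    rw [betaHat, pilotVar]
    field_simp
  rw [estimateScale, mul_pow, Real.sq_sqrt h1.le, h5, mmseCoeff, div_pow, mul_pow,
    Real.sq_sqrt (by positivity)]
  field_simp

variable [IsProbabilityMeasure μ]

/-- For fixed symbols the signal is affine in the Gaussian error, so its second moment involves only
the |x_j|², each of mean 1. Correlations between symbols never enter. -/
lemma lintegral_streamSignal (hS : S.Model μ) (hM : 0 < M) (i : Fin L) (k : Fin K) (b : ℝ)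
    (a : Fin M → ℂ) :
    ∫⁻ p, ‖S.streamSignal i k b a p.1 p.2‖ₑ ^ 2
      ∂(μ.map fun ω => (S.normError i ω, S.symbol i ω)) =
      (∑ m, ‖a m‖ₑ ^ 2) * ENNReal.ofReal (S.errorPower μ i) + ENNReal.ofReal (b ^ 2) := by
  have hx := measurable_symbol hS i
  have : IsProbabilityMeasure (μ.map (S.symbol i)) := Measure.isProbabilityMeasure_map hx.aemeasurable
  have hmeas : Measurable fun p : (Fin K × Fin M → ℂ) × (Fin K → ℂ) =>
      ‖S.streamSignal i k b a p.1 p.2‖ₑ ^ 2 := by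
    unfold streamSignal
    fun_prop
  have hsym : ∀ j, ∫⁻ x, ‖x j‖ₑ ^ 2 ∂(μ.map (S.symbol i)) = 1 := fun j => by
    rw [lintegral_map (by fun_prop) hx]
    exact lintegral_enorm_sq_eq_one _ ((hS.symbol_covariance i j j).trans (Matrix.one_apply_eq j))
  rw [(indepFun_normPilot_prod hS i).2, lintegral_prod_symm _ hmeas.aemeasurable]
  simp_rw [streamSignal_eq_dotProduct, lintegral_enorm_sq_dotProduct_add, enorm_mul, mul_pow,
    enorm_real_sq, Real.sq_sqrt (errorVar_pos hS i _).le, enorm_complex_star]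
  rw [lintegral_add_left (by fun_prop), lintegral_finsetSum _ (fun _ _ => by fun_prop),
    lintegral_const_mul _ (by fun_prop), hsym, mul_one]
  congr 1
  rw [errorPower_eq hS hM, ENNReal.ofReal_sum_of_nonneg fun j _ => (errorVar_pos hS i j).le,
    Fintype.sum_prod_type, Finset.sum_comm, Finset.sum_mul]
  refine Finset.sum_congr rfl fun m _ => ?_
  rw [Finset.mul_sum]
  refine Finset.sum_congr rfl fun j _ => ?_
  rw [lintegral_const_mul _ (by fun_prop), hsym, mul_one]

lemma condLExp_streamSignal (hS : S.Model μ) (hM : 0 < M) (i : Fin L) (k : Fin K) (b : ℝ) :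
    condLExp S.csi μ (fun ω => ‖S.streamSignal i k b (fun m => S.zfReceiver ω m k)
      (S.normError i ω) (S.symbol i ω)‖ₑ ^ 2) =ᵐ[μ]
      fun ω => S.zfPower k ω * ENNReal.ofReal (S.errorPower μ i) + ENNReal.ofReal (b ^ 2) := by
  let A : (Fin M → Fin K → ℂ) → Fin M → ℂ := fun W m =>
    (Matrix.of W * ((Matrix.of W)ᴴ * Matrix.of W)⁻¹) m k
  have hA : Measurable A := measurable_pi_lambda _ fun m => measurable_zfMatrix m k
  have hf : Measurable (Function.uncurry fun (W : Fin M → Fin K → ℂ)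
      (p : (Fin K × Fin M → ℂ) × (Fin K → ℂ)) => ‖S.streamSignal i k b (A W) p.1 p.2‖ₑ ^ 2) := by
    have hA' : ∀ m, Measurable fun p : (Fin M → Fin K → ℂ) × ((Fin K × Fin M → ℂ) × (Fin K → ℂ)) =>
        star (A p.1 m) := fun m =>
      continuous_star.measurable.comp ((measurable_pi_apply m).comp (hA.comp measurable_fst))
    unfold streamSignal Function.uncurry
    fun_prop
  have h := condLExp_comap_of_indepFun (measurable_channelEstimate hS)
    ((measurable_normError hS i).prodMk (measurable_symbol hS i))
    (indepFun_channelEstimate hS (indepFun_normPilot_prod hS i).1) _ hf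
  refine h.trans (Filter.Eventually.of_forall fun ω => ?_)
  exact lintegral_streamSignal hS hM i k b _

lemma condLExp_noise (hS : S.Model μ) (k : Fin K) :
    condLExp S.csi μ (fun ω => ‖((S.zfReceiver ω)ᴴ *ᵥ S.noise ω) k‖ₑ ^ 2 /
      ENNReal.ofReal S.power) =ᵐ[μ] fun ω => S.zfPower k ω * ENNReal.ofReal (1 / S.power) := by
  let A : (Fin M → Fin K → ℂ) → Fin M → ℂ := fun W m =>
    (Matrix.of W * ((Matrix.of W)ᴴ * Matrix.of W)⁻¹) m k
  have hA : Measurable A := measurable_pi_lambda _ fun m => measurable_zfMatrix m k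
  have hf : Measurable (Function.uncurry fun (W : Fin M → Fin K → ℂ) (n : Fin M → ℂ) =>
      ‖(fun m => star (A W m)) ⬝ᵥ n + 0‖ₑ ^ 2 / ENNReal.ofReal S.power) := by
    have hA' : ∀ m, Measurable fun p : (Fin M → Fin K → ℂ) × (Fin M → ℂ) =>
        star (A p.1 m) := fun m =>
      continuous_star.measurable.comp ((measurable_pi_apply m).comp (hA.comp measurable_fst))
    unfold dotProduct Function.uncurry
    fun_prop
  obtain ⟨-, h2, h3⟩ := law_normPilot_noise hS
  have h := condLExp_comap_of_indepFun (measurable_channelEstimate hS) (measurable_noise hS)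
    (indepFun_channelEstimate hS h3) _ hf
  have he : (fun ω => ‖((S.zfReceiver ω)ᴴ *ᵥ S.noise ω) k‖ₑ ^ 2 / ENNReal.ofReal S.power) =
      fun ω => ‖(fun m => star (A (fun m k => S.channelEstimate S.cell ω m k) m)) ⬝ᵥ S.noise ω +
        0‖ₑ ^ 2 / ENNReal.ofReal S.power := by
    ext ω
    rw [add_zero]
    rfl
  rw [he]
  refine h.trans (Filter.Eventually.of_forall fun ω => ?_)
  simp only [div_eq_mul_inv]
  rw [lintegral_mul_const _ (by unfold dotProduct; fun_prop), h2,
    lintegral_enorm_sq_dotProduct_add, one_mul, ENNReal.ofReal_inv_of_pos hS.power_pos]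
  simp only [enorm_complex_star, enorm_zero, ne_eq, OfNat.ofNat_ne_zero, not_false_eq_true, zero_pow,
    add_zero]
  rfl

/-- Interference and noise after zero forcing. -/
theorem interferencePower_ae_eq (hS : S.Model μ) (hKM : K ≤ M) (k : Fin K) :
    S.interferencePower μ k =ᵐ[μ] fun ω => ENNReal.ofReal (S.eta k) +
      S.zfPower k ω * ENNReal.ofReal (∑ i, S.errorPower μ i + 1 / S.power) := by
  have hM : 0 < M := (Nat.zero_le _).trans_lt k.isLt |>.trans_le hKM
  have hdet := ae_channelEstimate_det_ne_zero hS hKM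
  have hα : ∀ i, 0 ≤ S.errorPower μ i := fun i => by
    rw [errorPower_eq hS hM]
    exact Finset.sum_nonneg fun j _ => (errorVar_pos hS i j).le
  have h1 : condLExp S.csi μ (fun ω => ‖((S.zfReceiver ω)ᴴ *ᵥ
      (S.estimationError S.cell ω *ᵥ S.symbol S.cell ω)) k‖ₑ ^ 2) =ᵐ[μ]
      fun ω => S.zfPower k ω * ENNReal.ofReal (S.errorPower μ S.cell) := by
    have he : (fun ω => ‖((S.zfReceiver ω)ᴴ *ᵥ
        (S.estimationError S.cell ω *ᵥ S.symbol S.cell ω)) k‖ₑ ^ 2) =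
        fun ω => ‖S.streamSignal S.cell k 0 (fun m => S.zfReceiver ω m k)
          (S.normError S.cell ω) (S.symbol S.cell ω)‖ₑ ^ 2 := by
      ext ω
      rw [← mulVec_error_add hS S.cell k 0 ω 0
        (by rw [Matrix.mul_zero, Complex.ofReal_zero, Pi.single_zero]; rfl), zero_add]
    rw [he]
    refine (condLExp_streamSignal hS hM S.cell k 0).trans (Filter.Eventually.of_forall fun ω => ?_)
    simp
  have h2 : condLExp S.csi μ (fun ω => ∑ i ∈ Finset.univ.erase S.cell,
      ‖((S.zfReceiver ω)ᴴ *ᵥ (S.channel i ω *ᵥ S.symbol i ω)) k‖ₑ ^ 2) =ᵐ[μ]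
      fun ω => ∑ i ∈ Finset.univ.erase S.cell, (S.zfPower k ω * ENNReal.ofReal (S.errorPower μ i) +
        ENNReal.ofReal ((S.gain i k / S.gain S.cell k) ^ 2)) := by
    have he : (fun ω => ∑ i ∈ Finset.univ.erase S.cell,
        ‖((S.zfReceiver ω)ᴴ *ᵥ (S.channel i ω *ᵥ S.symbol i ω)) k‖ₑ ^ 2) =ᵐ[μ]
        fun ω => ∑ i ∈ Finset.univ.erase S.cell,
          ‖S.streamSignal i k (S.gain i k / S.gain S.cell k) (fun m => S.zfReceiver ω m k)
            (S.normError i ω) (S.symbol i ω)‖ₑ ^ 2 := by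
      -- Only almost surely: A†Ĝ_ℓ = 1 needs an invertible Gram matrix.
      filter_upwards [hdet] with ω hω
      refine Finset.sum_congr rfl fun i _ => ?_
      rw [← mulVec_error_add hS i k _ ω (S.channelEstimate i ω), estimationError, add_sub_cancel]
      rw [channelEstimate_eq_cell_mul hS i, ← Matrix.mul_assoc, zfReceiver,
        zfMatrix_conjTranspose_mul _ hω, Matrix.one_mul]
      ext j
      rw [Matrix.diagonal_apply, Pi.single_apply]
      by_cases hkj : k = j
      · subst hkj; simp
      · simp [hkj, Ne.symm hkj]
    refine (condLExp_congr_ae he).trans ?_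
    have hms : ∀ i ∈ Finset.univ.erase S.cell, Measurable fun ω =>
        ‖S.streamSignal i k (S.gain i k / S.gain S.cell k) (fun m => S.zfReceiver ω m k)
            (S.normError i ω) (S.symbol i ω)‖ₑ ^ 2 := fun i _ => by
      have hA : ∀ m, Measurable fun ω => star (S.zfReceiver ω m k) := fun m =>
        continuous_star.measurable.comp
          ((measurable_zfMatrix m k).comp (measurable_channelEstimate hS))
      have hE := measurable_normError hS i
      have hx := measurable_symbol hS i
      unfold streamSignal
      fun_prop
    refine (condLExp_finset_sum S.csi (measurable_channelEstimate hS).comap_le _ _ hms).trans ?_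
    have hall := Filter.eventually_all.2 fun i =>
      condLExp_streamSignal hS hM i k (S.gain i k / S.gain S.cell k)
    filter_upwards [hall] with ω hω
    exact Finset.sum_congr rfl fun i _ => hω i
  filter_upwards [h1, h2, condLExp_noise hS k] with ω h1 h2 h3
  rw [interferencePower, h1, h2, h3, Finset.sum_add_distrib, ← Finset.mul_sum,
    ← ENNReal.ofReal_sum_of_nonneg fun i _ => hα i,
    ← ENNReal.ofReal_sum_of_nonneg fun i _ => sq_nonneg _,
    ← Finset.add_sum_erase Finset.univ (S.errorPower μ) (Finset.mem_univ S.cell),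
    ENNReal.ofReal_add (add_nonneg (hα _) (Finset.sum_nonneg fun i _ => hα i))
      (one_div_pos.2 hS.power_pos).le,
    ENNReal.ofReal_add (hα _) (Finset.sum_nonneg fun i _ => hα i)]
  simp_rw [div_pow]
  rw [← Finset.sum_div, ← eta]
  ring

end UplinkSystem

/-! ### The outage event and its probability -/

namespace UplinkSystem

variable {L M K τ : ℕ} {Ω : Type*} {S : UplinkSystem L M K τ Ω}
/-- Squared norm of the `k`-th zero-forcing column built from the normalised pilots. -/
noncomputable def normZfNormSq (S : UplinkSystem L M K τ Ω) (k : Fin K) (ω : Ω) : ℝ :=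
  zfNormSq (Matrix.of fun m k => S.normPilot ω (k, m)) k

variable [MeasurableSpace Ω] {μ : Measure Ω}

lemma measurable_normZfNormSq (hS : S.Model μ) (k : Fin K) : Measurable (S.normZfNormSq k) :=
  (measurable_zfNormSq k).comp (f := fun ω (m : Fin M) (k : Fin K) => S.normPilot ω (k, m)) (by
    have := measurable_normPilot hS
    fun_prop)

lemma eta_pos (hS : S.Model μ) (hL : 1 < L) (k : Fin K) : 0 < S.eta k := by
  have h : (Finset.univ.erase S.cell).Nonempty := by
    rw [← Finset.card_pos, Finset.card_erase_of_mem (Finset.mem_univ _), Finset.card_univ,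
      Fintype.card_fin]
    omega
  exact div_pos (Finset.sum_pos (fun i _ => pow_pos (hS.gain_pos i k) 2) h)
    (pow_pos (hS.gain_pos _ k) 2)

variable [IsProbabilityMeasure μ]

/-- The column k competes with K - 1 others, whose orthogonal complement has dimension M - K + 1. -/
lemma measure_normZfNormSq (hS : S.Model μ) (hKM : K ≤ M) (k : Fin K) {x : ℝ} (hx : 0 ≤ x) :
    μ {ω | x * S.normZfNormSq k ω ≤ 1} = ENNReal.ofReal (erlangTail (M - K + 1) x) := by
  obtain ⟨n, rfl⟩ : ∃ n, K = n + 1 := ⟨K - 1, by have := k.isLt; omega⟩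
  have hP := (law_normPilot_normError hS S.cell).1
  have hc := map_curry_pi_stdComplexGaussian (Fin (n + 1)) (Fin M)
  rw [← hP, Measure.map_map (by fun_prop) (measurable_normPilot hS)] at hc
  have hq : Measurable fun G : Fin (n + 1) → Fin M → ℂ =>
      zfNormSq (Matrix.of fun i j => G j i) k :=
    (measurable_zfNormSq k).comp (f := fun G : Fin (n + 1) → Fin M → ℂ =>
      (fun i j => G j i : Fin M → Fin (n + 1) → ℂ)) (by fun_prop)
  have h := pi_stdComplexGaussian_zfNormSq n hKM k hx
  rw [← hc, Measure.map_apply (Measurable.comp (by fun_prop) (measurable_normPilot hS))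
    (measurableSet_le (hq.const_mul x) measurable_const)] at h
  rw [show M - (n + 1) + 1 = M - n by omega, ← h]
  rfl

lemma ae_normZfNormSq_pos (hS : S.Model μ) (hKM : K ≤ M) (k : Fin K) :
    ∀ᵐ ω ∂μ, 0 < S.normZfNormSq k ω := by
  filter_upwards [ae_channelEstimate_det_ne_zero hS hKM] with ω hω
  have h1 := zfPower_eq hS k ω
  have h2 := zfNormSq_pos _ hω k
  have h3 : S.zfPower k ω = ENNReal.ofReal (zfNormSq (S.channelEstimate S.cell ω) k) := by
    rw [zfPower, zfNormSq, ENNReal.ofReal_sum_of_nonneg fun _ _ => by positivity]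
    refine Finset.sum_congr rfl fun m _ => ?_
    rw [ENNReal.ofReal_pow (norm_nonneg _), ofReal_norm]
    rfl
  rw [h3] at h1
  have h4 : 0 < ENNReal.ofReal (zfNormSq (Matrix.of fun m k => S.normPilot ω (k, m)) k /
      S.estimateScale k ^ 2) := h1 ▸ ENNReal.ofReal_pos.2 h2
  have h5 := ENNReal.ofReal_pos.1 h4
  have h6 : 0 < S.estimateScale k ^ 2 := pow_pos (estimateScale_pos hS k) 2
  exact (div_pos_iff_of_pos_right h6).1 h5

lemma theta_pos (hS : S.Model μ) (hKM : K ≤ M) (k : Fin K) : 0 < S.theta μ k := by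
  have hM : 0 < M := (Nat.zero_le _).trans_lt k.isLt |>.trans_le hKM
  have h1 : 0 ≤ ∑ i, S.errorPower μ i := Finset.sum_nonneg fun i _ => by
    rw [errorPower_eq hS hM]
    exact Finset.sum_nonneg fun j _ => (errorVar_pos hS i j).le
  have h2 := hS.power_pos
  have h3 := hS.gain_pos S.cell k
  have h4 : 0 ≤ ∑ j, S.gain j k := Finset.sum_nonneg fun j _ => (hS.gain_pos j k).le
  have h5 : (0 : ℝ) < τ := Nat.cast_pos.2 (pilot_length_pos hS k)
  unfold theta betaHat
  positivity

/-- The outage event, up to a null set. -/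
lemma outage_ae_eq (hS : S.Model μ) (hKM : K ≤ M) (k : Fin K) (γ : ℝ) :
    ∀ᵐ ω ∂μ, S.sinr μ k ω < ENNReal.ofReal γ ↔
      1 < S.eta k * γ + S.theta μ k * γ * S.normZfNormSq k ω := by
  have hθ := theta_pos hS hKM k
  have hη : 0 ≤ S.eta k := by unfold eta; positivity
  have hs2 : 0 < S.estimateScale k ^ 2 := pow_pos (estimateScale_pos hS k) 2
  have hθ' : S.theta μ k = (∑ i, S.errorPower μ i + 1 / S.power) / S.estimateScale k ^ 2 := by
    rw [theta, estimateScale_sq hS, div_div_eq_mul_div, div_mul_eq_mul_div, mul_comm]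
  filter_upwards [interferencePower_ae_eq hS hKM k, ae_normZfNormSq_pos hS hKM k] with ω h1 h2
  have ht : 0 < S.eta k + S.theta μ k * S.normZfNormSq k ω := by positivity
  have h3 : S.interferencePower μ k ω =
      ENNReal.ofReal (S.eta k + S.theta μ k * S.normZfNormSq k ω) := by
    have hz : S.zfPower k ω = ENNReal.ofReal (S.normZfNormSq k ω / S.estimateScale k ^ 2) :=
      zfPower_eq hS k ω
    rw [h1, hz, ← ENNReal.ofReal_mul (div_nonneg h2.le hs2.le),
      ← ENNReal.ofReal_add hη, hθ']
    · congr 2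
      ring
    · refine mul_nonneg (div_nonneg h2.le hs2.le) ?_
      rw [eq_div_iff hs2.ne'] at hθ'
      rw [← hθ']
      positivity
  rw [sinr, h3, ← ENNReal.ofReal_inv_of_pos ht,
    ENNReal.ofReal_lt_ofReal_iff_of_nonneg (inv_pos.2 ht).le, inv_lt_iff_one_lt_mul₀ ht]
  rw [show γ * (S.eta k + S.theta μ k * S.normZfNormSq k ω) =
    S.eta k * γ + S.theta μ k * γ * S.normZfNormSq k ω by ring]

end UplinkSystem

theorem mainTheorem4 {L M K τ : ℕ} (hL : 1 < L) (hKM : K ≤ M)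
    {Ω : Type*} [MeasurableSpace Ω] (μ : Measure Ω) [IsProbabilityMeasure μ]
    (S : UplinkSystem L M K τ Ω) (hS : S.Model μ) (k : Fin K) (γth : ℝ) (hγ : 0 ≤ γth) :
    (∀ i, S.errorPower μ i = ∑ j, (S.gain i j -
      τ * S.power * S.gain i j ^ 2 / (τ * S.power * ∑ i', S.gain i' j + 1))) ∧
    (γth < 1 / S.eta k → S.outageProbability μ k γth =
      1 - Real.exp (-(S.theta μ k * γth / (1 - S.eta k * γth))) *
        ∑ i ∈ Finset.range (M - K + 1),
          (S.theta μ k * γth / (1 - S.eta k * γth)) ^ i / (Nat.factorial i : ℝ)) ∧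
    (1 / S.eta k ≤ γth → S.outageProbability μ k γth = 1) := by
  have hM : 0 < M := (Nat.zero_le _).trans_lt k.isLt |>.trans_le hKM
  have hη := UplinkSystem.eta_pos hS hL k
  have hθ := UplinkSystem.theta_pos hS hKM k
  have hev : S.outageProbability μ k γth =
      μ.real {ω | 1 < S.eta k * γth + S.theta μ k * γth * S.normZfNormSq k ω} := by
    rw [UplinkSystem.outageProbability]
    refine measureReal_congr ?_
    filter_upwards [UplinkSystem.outage_ae_eq hS hKM k γth] with ω hω
    exact propext hω
  refine ⟨fun i => UplinkSystem.errorPower_eq hS hM i, fun h => ?_, fun h => ?_⟩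
  · have hd : 0 < 1 - S.eta k * γth := by
      rw [lt_div_iff₀ hη] at h
      linarith
    set x := S.theta μ k * γth / (1 - S.eta k * γth) with hx
    have hx0 : 0 ≤ x := by positivity
    -- Dividing by 1 - ηγ > 0 turns non-outage into an Erlang tail event at level x.
    have hset : {ω | 1 < S.eta k * γth + S.theta μ k * γth * S.normZfNormSq k ω} =
        {ω | x * S.normZfNormSq k ω ≤ 1}ᶜ := by
      ext ω
      change _ ↔ ¬ (x * S.normZfNormSq k ω ≤ 1)
      rw [hx, div_mul_eq_mul_div, div_le_one hd, not_le, sub_lt_iff_lt_add']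
      rfl
    rw [hev, hset, probReal_compl_eq_one_sub (measurableSet_le
      ((UplinkSystem.measurable_normZfNormSq hS k).const_mul x) measurable_const), measureReal_def,
      UplinkSystem.measure_normZfNormSq hS hKM k hx0, ENNReal.toReal_ofReal (erlangTail_nonneg _ hx0), erlangTail]
  · have hγ' : 0 < γth := (one_div_pos.2 hη).trans_le h
    rw [div_le_iff₀' hη] at h
    -- Here ηγ ≥ 1 already, and the almost surely positive second term makes the inequality strict,
    -- also at γ = 1/η.
    have hae : {ω | 1 < S.eta k * γth + S.theta μ k * γth * S.normZfNormSq k ω} =ᵐ[μ] Set.univ := by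
      refine Filter.eventuallyEq_univ.2 ?_
      filter_upwards [UplinkSystem.ae_normZfNormSq_pos hS hKM k] with ω hω
      have : 0 < S.theta μ k * γth * S.normZfNormSq k ω := by positivity
      change 1 < _
      linarith
    rw [hev, measureReal_congr hae, probReal_univ]
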